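/- **Setting.** Let $\mathbb T^2=\mathbb R^2/\mathbb Z^2$, $\nu>0$, and $\mathcal V=\{v\in H^1(\mathbb T^2;\mathbb R^2):\nabla\cdot v=0\}$ with $\|v\|_{\mathcal V}^2=\|v\|^2+\|\nabla v\|^2$, where $\|\cdot\|$ is the $L^2$ norm. Let $\mathcal V'$ be its dual with the norm $\|F\|_{\mathcal V'}=\sup_{\|v\|_{\mathcal V}\le1}|\langle F,v\rangle|$ (so $\mathcal V\subset L^2\to\mathcal V'$ through the $L^2$ inner product), and put $c(z,u,v)=\int_{\mathbb T^2}((z\cdot\nabla)u)\cdot v\,dx$. For $a<b$ let $W(a,b)$ be the set of $u\in L^2(a,b;\mathcal V)$ with weak time derivative $\partial_tu\in L^2(a,b;\mathcal V')$. Let $f\in L^2(a,b;\mathcal V')$. A weak solution of the incompressible Navier–Stokes equations on $[a,b]$ is $u\in W(a,b)$ such that, for a.e. $t$, $\langle\partial_tu,v\rangle+c(u,u,v)+\nu(\nabla u,\nabla v)=\langle f,v\rangle$ for all $v\in\mathcal V$. The residual of an approximation $u_{\mathcal N}\in W(a,b)$ is defined, for a.e. $t$ and all $v\in\mathcal V$,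 by $$\langle R(u_{\mathcal N}),v\rangle=\langle f-\partial_tu_{\mathcal N},v\rangle-c(u_{\mathcal N},u_{\mathcal N},v)-\nu(\nabla u_{\mathcal N},\nabla v).$$ **Theorem.** The residual is well defined: $R(u_{\mathcal N})\in L^2(a,b;\mathcal V')$ for every $u_{\mathcal N}\in W(a,b)$. Moreover: *Part I (efficiency).* For all $a<b$ and $M$ there is a constant $C$, depending only on $\nu,a,b,M$, such that for every $f$, every weak solution $u$ with $\|u\|_{L^\infty(a,b;L^2)}\le M$ and $\|u\|_{L^2(a,b;\mathcal V)}^2\le M^2$, and every $u_{\mathcal N}\in W(a,b)$ with $\|u_{\mathcal N}\|_{L^\infty(a,b;L^2)}\le N$, $$\|R(u_{\mathcal N})\|^2_{L^2(a,b;\mathcal V')}\le C(1+N^2)\left(\|u-u_{\mathcal N}\|^2_{L^2(a,b;\mathcal V)}+\|\partial_t(u-u_{\mathcal N})\|^2_{L^2(a,b;\mathcal V')}\right).$$ *Part II (reliability).* There are constants $\kappa>0$ and $C$ depending only on $\nu$ with the following property. Let $u$ be a weak solution on $[a,b]$, let $u_{\mathcal N}\in W(a,b)$ and $e=u-u_{\mathcal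 N}$, let $[t_m,t_{m+1}]\subset[a,b]$ with $t_m<t_{m+1}$, and suppose $\int_{\mathbb T^2}e(t,x)\,dx=0$ for a.e. $t\in[t_m,t_{m+1}]$. Assume at least one of the following. (i) (Sufficient closeness) For a.e. $t\in[t_m,t_{m+1}]$, $\|(e\cdot\nabla)u_{\mathcal N}\|_{\mathcal V'}\le\frac\nu2\|\nabla e\|$. (ii) (Gårding inequality) With $B(z,v;u)=\langle\partial_tz,v\rangle+\nu(\nabla z,\nabla v)+c(u,z,v)+c(z,u,v)$, there are $\alpha,\beta>0$ with $\alpha-\beta\ge\nu$ such that, for a.e. $t\in[t_m,t_{m+1}]$, $B(e,e;u)+\beta\|e\|^2\ge\frac{d}{dt}\|e\|^2+\alpha\|\nabla e\|^2$, where $\frac{d}{dt}\|e\|^2=2\langle\partial_te,e\rangle$. Then $e$ has a representative in $C([t_m,t_{m+1}];L^2)$, and for this representative and every $t\in[t_m,t_{m+1}]$ $$\|e(t)\|^2+\kappa\int_{t_m}^t\|e\|_{\mathcal V}^2\,d\tau\le\|e(t_m)\|^2+C\int_{t_m}^t\|R(u_{\mathcal N})\|_{\mathcal V'}^2\,d\tau,$$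 and $$\sup_{[t_m,t_{m+1}]}\|e\|^2+\int_{t_m}^{t_{m+1}}\|e\|_{\mathcal V}^2\,d\tau\le C\left(\|e(t_m)\|^2+\int_{t_m}^{t_{m+1}}\|R(u_{\mathcal N})\|_{\mathcal V'}^2\,d\tau\right).$$ -/

import Mathlib

open MeasureTheory Set
open scoped ENNReal ContDiff

noncomputable section

namespace PeriodicNSE

/-- The flat unit torus `𝕋² = ℝ²/ℤ²`. -/
abbrev Torus : Type := UnitAddTorus (Fin 2)

/-- Lebesgue measure on the unit torus: the product of the normalised Haar (= arc length)
measures of the two circles `ℝ/ℤ`. -/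
abbrev torusMeasure : Measure Torus :=
  Measure.pi fun _ : Fin 2 => (AddCircle.haarAddCircle : Measure (AddCircle (1 : ℝ)))

/-- Vectors in `ℝ²` with the Euclidean norm. -/
abbrev Vec : Type := EuclideanSpace ℝ (Fin 2)

/-- Real `2 × 2` matrices with the Frobenius norm. -/
abbrev Mat : Type := EuclideanSpace ℝ (Fin 2 × Fin 2)

/-- The space `L²(𝕋²; ℝ²)`. -/
abbrev L2Vec : Type := Lp Vec 2 torusMeasure

/-- The space `L²(𝕋²; ℝ^{2 × 2})`. -/
abbrev L2Mat : Type := Lp Mat 2 torusMeasure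

/-- `G` is the weak gradient of `v`, i.e. `G i j = ∂_j v_i` in the sense of periodic distributions:
testing against the characters `exp (2 π i k · x)`, whose span is dense in `C^∞(𝕋²)`, the Fourier
coefficients satisfy `(G i j)^(k) = 2 π i k_j (v_i)^(k)`. -/
def IsWeakGradient (v : L2Vec) (G : L2Mat) : Prop :=
  ∀ (i j : Fin 2) (k : Fin 2 → ℤ),
    UnitAddTorus.mFourierCoeff (fun x : Torus => ((G x (i, j) : ℝ) : ℂ)) k =
      (2 * Real.pi * Complex.I * (k j : ℂ)) *
        UnitAddTorus.mFourierCoeff (fun x : Torus => ((v x i : ℝ) : ℂ)) k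

lemma integrable_coord {ι : Type} [Fintype ι] (k : Fin 2 → ℤ)
    (w : Lp (EuclideanSpace ℝ ι) 2 torusMeasure) (p : ι) :
    Integrable (fun x : Torus => UnitAddTorus.mFourier (-k) x • ((w x p : ℝ) : ℂ))
      torusMeasure := by
  have hw : Integrable (fun x => w x) torusMeasure :=
    (Lp.memLp w).integrable (by norm_num)
  have h1 : Integrable (fun x => ((w x p : ℝ) : ℂ)) torusMeasure :=
    ((EuclideanSpace.proj (𝕜 := ℝ) p).integrable_comp hw).ofReal
  refine h1.bdd_mul (c := 1)
    (UnitAddTorus.mFourier (-k)).continuous.aestronglyMeasurable (.of_forall fun x => ?_)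
  exact ((UnitAddTorus.mFourier (-k)).norm_coe_le_norm x).trans UnitAddTorus.mFourier_norm.le

lemma coeff_add {ι : Type} [Fintype ι] (k : Fin 2 → ℤ)
    (w z : Lp (EuclideanSpace ℝ ι) 2 torusMeasure) (p : ι) :
    UnitAddTorus.mFourierCoeff (fun x : Torus => (((w + z : Lp _ 2 torusMeasure) x p : ℝ) : ℂ)) k =
      UnitAddTorus.mFourierCoeff (fun x : Torus => ((w x p : ℝ) : ℂ)) k +
        UnitAddTorus.mFourierCoeff (fun x : Torus => ((z x p : ℝ) : ℂ)) k := by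
  refine Eq.trans ?_ (integral_add (integrable_coord k w p) (integrable_coord k z p))
  refine integral_congr_ae (μ := torusMeasure) ?_
  filter_upwards [Lp.coeFn_add w z] with x hx
  rw [hx]
  simp only [Pi.add_apply, PiLp.add_apply, Complex.ofReal_add, smul_eq_mul, mul_add]

lemma coeff_smul {ι : Type} [Fintype ι] (k : Fin 2 → ℤ) (c : ℝ)
    (w : Lp (EuclideanSpace ℝ ι) 2 torusMeasure) (p : ι) :
    UnitAddTorus.mFourierCoeff (fun x : Torus => (((c • w : Lp _ 2 torusMeasure) x p : ℝ) : ℂ)) k =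
      (c : ℂ) * UnitAddTorus.mFourierCoeff (fun x : Torus => ((w x p : ℝ) : ℂ)) k := by
  refine Eq.trans ?_ (integral_const_mul (μ := torusMeasure) (c : ℂ) _)
  refine integral_congr_ae (μ := torusMeasure) ?_
  filter_upwards [Lp.coeFn_smul c w] with x hx
  simp [hx]
  ring

/-- The space `𝒱 = {v ∈ H¹(𝕋²; ℝ²) : div v = 0}`. An element is recorded as the pair `(v, ∇v)`,
so that the inherited Hilbert norm is the `H¹` norm `‖v‖² = ‖v‖²_{L²} + ‖∇v‖²_{L²}`. -/
def V : Submodule ℝ (WithLp 2 (L2Vec × L2Mat)) where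
  carrier := {w | IsWeakGradient w.fst w.snd ∧
    ∀ᵐ x ∂torusMeasure, w.snd x (0, 0) + w.snd x (1, 1) = 0}
  add_mem' := by
    rintro w z ⟨hw, hw'⟩ ⟨hz, hz'⟩
    refine ⟨fun i j k => ?_, ?_⟩
    · rw [WithLp.add_fst, WithLp.add_snd, coeff_add, coeff_add, hw, hz, mul_add]
    · rw [WithLp.add_snd]
      filter_upwards [hw', hz', Lp.coeFn_add w.snd z.snd] with x h1 h2 h3
      rw [h3]
      simp only [Pi.add_apply, PiLp.add_apply]
      linarith
  zero_mem' := by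
    refine ⟨fun i j k => ?_, ?_⟩
    · have h1 := coeff_smul k 0 (0 : L2Mat) (i, j)
      have h2 := coeff_smul k 0 (0 : L2Vec) i
      simp only [smul_zero, Complex.ofReal_zero, zero_mul] at h1 h2
      rw [WithLp.zero_fst, WithLp.zero_snd, h1, h2, mul_zero]
    · rw [WithLp.zero_snd]
      filter_upwards [Lp.coeFn_zero Mat 2 torusMeasure] with x hx
      rw [hx]
      simp
  smul_mem' := by
    rintro c w ⟨hw, hw'⟩
    refine ⟨fun i j k => ?_, ?_⟩
    · rw [WithLp.smul_fst, WithLp.smul_snd, coeff_smul, coeff_smul, hw]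
      ring
    · rw [WithLp.smul_snd]
      filter_upwards [hw', Lp.coeFn_smul c w.snd] with x h1 h2
      rw [h2]
      simp only [Pi.smul_apply, PiLp.smul_apply, smul_eq_mul]
      rw [← mul_add, h1, mul_zero]

/-- The dual space `𝒱'`, whose norm is `‖F‖_{𝒱'} = sup {|⟨F, v⟩| : ‖v‖_𝒱 ≤ 1}`. -/
abbrev VDual : Type := StrongDual ℝ V

/-- The velocity field `v ∈ L²(𝕋²; ℝ²)` underlying an element of `𝒱`. -/
def vel (v : V) : L2Vec := (v : WithLp 2 (L2Vec × L2Mat)).fst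

/-- The weak gradient `∇v`, with entries `(i, j) ↦ ∂_j v_i`. -/
def grad (v : V) : L2Mat := (v : WithLp 2 (L2Vec × L2Mat)).snd

/-- The convection form `c(z, u, v) = ((z · ∇) u, v) = ∫ ∑_{i,j} z_j ∂_j u_i v_i`. -/
def convection (z u v : V) : ℝ :=
  ∫ x, ∑ i : Fin 2, ∑ j : Fin 2, vel z x j * grad u x (i, j) * vel v x i ∂torusMeasure

/-- `u'` is the time derivative of `u` on `(a, b)` in the sense of `𝒱'`-valued distributions, where
`𝒱` is embedded in `𝒱'` through the `L²` inner product. -/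
def IsWeakTimeDeriv (a b : ℝ) (u : ℝ → V) (u' : ℝ → VDual) : Prop :=
  ∀ φ : ℝ → ℝ, ContDiff ℝ ∞ φ → HasCompactSupport φ → tsupport φ ⊆ Ioo a b → ∀ v : V,
    ∫ t in Icc a b, deriv φ t * inner ℝ (vel (u t)) (vel v) =
      -∫ t in Icc a b, φ t * u' t v

/-- `u ∈ L²(a, b; 𝒱)` with `∂_t u = u' ∈ L²(a, b; 𝒱')`. -/
structure IsTrajectory (a b : ℝ) (u : ℝ → V) (u' : ℝ → VDual) : Prop where
  memLp : MemLp u 2 (volume.restrict (Icc a b))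
  memLp_deriv : MemLp u' 2 (volume.restrict (Icc a b))
  weakDeriv : IsWeakTimeDeriv a b u u'

/-- `u` is a weak solution on `[a, b]` of the incompressible Navier–Stokes equations
`∂_t u + (u · ∇) u - ν Δu + ∇p = f`, `div u = 0` on `𝕋²`. The pressure disappears because the
test functions are divergence free. -/
structure IsWeakSolution (ν a b : ℝ) (f : ℝ → VDual) (u : ℝ → V) (u' : ℝ → VDual) : Prop where
  trajectory : IsTrajectory a b u u'
  equation : ∀ᵐ t ∂volume.restrict (Icc a b), ∀ v : V,
    u' t v + convection (u t) (u t) v + ν * inner ℝ (grad (u t)) (grad v) = f t v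

/-- `R t = f - ∂_t w - (w · ∇) w + ν Δw` in `𝒱'`, for almost every `t ∈ [a, b]`. -/
def IsResidual (ν a b : ℝ) (f : ℝ → VDual) (w : ℝ → V) (w' R : ℝ → VDual) : Prop :=
  ∀ᵐ t ∂volume.restrict (Icc a b), ∀ v : V,
    R t v = f t v - w' t v - convection (w t) (w t) v - ν * inner ℝ (grad (w t)) (grad v)

/-- Closeness of `w` and `u` on `[s, r]`: with `e = u - w`, the nonlinear error term
`J(u, w) = (e · ∇) w` satisfies `‖J(u, w)‖_{𝒱'} ≤ γ ‖∇e‖_{L²}` for almost every time. -/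
def IsClose (γ s r : ℝ) (u w : ℝ → V) : Prop :=
  ∀ᵐ t ∂volume.restrict (Icc s r), ∀ v : V,
    |convection (u t - w t) (w t) v| ≤ γ * ‖grad (u t - w t)‖ * ‖v‖

/-- The form `B(z, v; u) = (∂_t z, v) + ν (∇z, ∇v) + ((u · ∇) z + (z · ∇) u, v)` of the
Navier–Stokes operator linearised at `u`, where `z'` stands for `∂_t z`. -/
def linearizedForm (ν : ℝ) (u z : V) (z' : VDual) (v : V) : ℝ :=
  z' v + ν * inner ℝ (grad z) (grad v) + (convection u z v + convection z u v)

/-- The Gårding inequality on `[s, r]` for `z`, with `∂_t z = z'`: there are `α, β > 0` with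
`α - β ≥ ν` and `B(z, z; u) + β ‖z‖² ≥ d/dt ‖z‖² + α ‖∇z‖²` for almost every time, where
`d/dt ‖z‖² = 2 ⟨∂_t z, z⟩`. -/
def SatisfiesGarding (ν s r : ℝ) (u z : ℝ → V) (z' : ℝ → VDual) : Prop :=
  ∃ α β : ℝ, 0 < α ∧ 0 < β ∧ ν ≤ α - β ∧
    ∀ᵐ t ∂volume.restrict (Icc s r),
      2 * z' t (z t) + α * ‖grad (z t)‖ ^ 2 ≤
        linearizedForm ν (u t) (z t) (z' t) (z t) + β * ‖vel (z t)‖ ^ 2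

end PeriodicNSE

end

/-!
The proof rests on three facts about `V` and on the bilinear structure of the equation.

*Evolution triple.* Let `J : V → L²` be the inclusion. A trajectory `u` with weak derivative `u'`
has a representative in `C([a, b]; L²)` and `‖u(t)‖² - ‖u(s)‖² = 2 ∫ₛᵗ ⟨u', u⟩`
(`IsTrajectory.exists_continuous`, from `exists_continuous_representative`). The weak derivative says
that `J*J u` is a primitive of the Riesz representative `r` of `u'`, so `J*J u` is absolutely
continuous with values in `V`. Multiplying by `Sₙ = ∑_{k < n} (1 - J*J)ᵏ`, which satisfies
`Sₙ J*J = 1 - (1 - J*J)ⁿ`, regularises `u`, and `(1 - J*J)ⁿ → 0` strongly because `J` is an injective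
contraction (`tendsto_defect_pow`). The energy identity for the regularised functions shows that they
are uniformly Cauchy in `L²`, and it passes to the limit.

*Ladyzhenskaya's inequality* `‖v‖_{L⁴}² ≤ C ‖v‖ ‖v‖_V` (`normFour_sq_le`). For a trigonometric
polynomial, `|p|²` at a point is at most the integral of `|p|² + 2 |p| |∂ᵢp|` along the `i`-th
coordinate circle through that point; multiplying the two bounds and integrating gives the estimate
by Fubini (`lintegral_trig_pow_four_le`), and Fatou's lemma extends it to all of `H¹`.

*Antisymmetry* `c(z, u, v) = -c(z, v, u)` (`convection_antisymm`). On Fourier coefficients, a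
divergence-free field is orthogonal to weak gradients; the Leibniz rule for the product with a
character is a shift of coefficients, and Ladyzhenskaya's inequality allows approximation by
trigonometric polynomials. Together with Hölder's inequality this gives
`‖c(z, u, ·)‖_{V'} ≤ ‖z‖_{L⁴} ‖u‖_{L⁴}`, hence the residual is in `L²(a, b; V')`.

*Efficiency.* With `e = u - w`, subtracting the equation for `u` gives
`R = ∂ₜe + c(e, u, ·) + c(w, e, ·) + ν (∇e, ∇·)`. The convective terms are controlled by
Ladyzhenskaya's inequality and the embedding of trajectories into `L^∞(a, b; L²)`.

*Reliability.* Testing with `e` itself gives `⟨∂ₜe, e⟩ = ⟨R, e⟩ - c(e, w, e) - ν ‖∇e‖²`. Since `e` has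
mean zero, Poincaré's inequality (`norm_vel_sq_le`) and either of the two hypotheses absorb the
convective term, so that `2 ⟨∂ₜe, e⟩ + (ν / 4) ‖e‖_V² ≤ (4 / ν) ‖R‖²` at almost every time. The energy
identity then yields the bounds with `κ = ν / 4`.
-/

namespace PeriodicNSE

open Filter Topology UnitAddTorus

/-! ### Absolutely continuous functions with values in a Hilbert space -/

section AbsCont

/-- A function whose increments are dominated by those of an absolutely continuous function is
absolutely continuous. -/
lemma absolutelyContinuous_of_dist_le {X : Type*} [PseudoMetricSpace X] {f : ℝ → X}
    {h : ℝ → ℝ} {a b : ℝ} (K : ℝ) (hh : AbsolutelyContinuousOnInterval h a b)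
    (hf : ∀ x ∈ uIcc a b, ∀ y ∈ uIcc a b, dist (f x) (f y) ≤ K * dist (h x) (h y)) :
    AbsolutelyContinuousOnInterval f a b := by
  unfold AbsolutelyContinuousOnInterval at hh ⊢
  refine squeeze_zero' ?_ ?_ (by simpa using hh.const_mul K)
  · exact Filter.Eventually.of_forall fun _ => Finset.sum_nonneg (fun i hi => dist_nonneg)
  rw [eventually_inf_principal]
  filter_upwards with (n, I) hnI
  rw [Finset.mul_sum]
  gcongr with i hi
  simp only [AbsolutelyContinuousOnInterval.disjWithin, mem_ofPred_eq] at hnI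
  exact hf _ (hnI.left i hi).left _ (hnI.left i hi).right

variable {E : Type*} [NormedAddCommGroup E] [InnerProductSpace ℝ E]

lemma dist_primitive_le {r : ℝ → E} {a b : ℝ} (hr : IntervalIntegrable r volume a b) (c : E) :
    ∀ x ∈ uIcc a b, ∀ y ∈ uIcc a b,
      dist (c + ∫ τ in a..x, r τ) (c + ∫ τ in a..y, r τ) ≤
        dist (∫ τ in a..x, ‖r τ‖) (∫ τ in a..y, ‖r τ‖) := by
  intro x hx y hy
  have hi : ∀ z ∈ uIcc a b, IntervalIntegrable r volume a z := fun z hz =>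
    hr.mono_set (uIcc_subset_uIcc left_mem_uIcc hz)
  rw [dist_add_left, dist_eq_norm, dist_eq_norm,
    intervalIntegral.integral_interval_sub_left (hi x hx) (hi y hy),
    intervalIntegral.integral_interval_sub_left (hi x hx).norm (hi y hy).norm]
  exact intervalIntegral.norm_integral_le_abs_integral_norm

/-- Product rule for the quadratic form of a symmetric operator along a primitive `g` of an
integrable function. -/
lemma inner_primitive_sub [CompleteSpace E] {A : E →L[ℝ] E} (hA : A.IsSymmetric) {r : ℝ → E} {a b : ℝ}
    (hr : IntervalIntegrable r volume a b) {g : ℝ → E} (c : E)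
    (hg : ∀ t, g t = c + ∫ τ in a..t, r τ) {s t : ℝ} (hs : s ∈ uIcc a b) (ht : t ∈ uIcc a b) :
    inner ℝ (A (g t)) (g t) - inner ℝ (A (g s)) (g s) =
      2 * ∫ τ in s..t, inner ℝ (A (g τ)) (r τ) := by
  have hgdist := dist_primitive_le hr c
  simp only [← hg] at hgdist
  have hac : AbsolutelyContinuousOnInterval (fun x => ∫ τ in a..x, ‖r τ‖) a b :=
    hr.norm.absolutelyContinuousOnInterval_intervalIntegral left_mem_uIcc
  obtain ⟨M, hM⟩ := (absolutelyContinuous_of_dist_le 1 hac (f := g) (by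
    simpa only [one_mul] using hgdist)).exists_bound
  have hqac : AbsolutelyContinuousOnInterval (fun x => inner ℝ (A (g x)) (g x)) a b := by
    refine absolutelyContinuous_of_dist_le (‖A‖ * (2 * M)) hac fun x hx y hy => ?_
    have h1 : inner ℝ (A (g x)) (g x) - inner ℝ (A (g y)) (g y) =
        inner ℝ (A (g x - g y)) (g x + g y) := by
      have : inner ℝ (A (g x)) (g y) = inner ℝ (A (g y)) (g x) := by
        rw [real_inner_comm]; exact (hA _ _).symm
      simp only [map_sub, inner_add_right, inner_sub_left, this]
      ring
    rw [Real.dist_eq, h1]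
    have h2 := hgdist x hx y hy
    rw [dist_eq_norm] at h2
    have h3 := hM x hx
    have h4 := hM y hy
    calc |inner ℝ (A (g x - g y)) (g x + g y)| ≤ ‖A (g x - g y)‖ * ‖g x + g y‖ :=
          abs_real_inner_le_norm _ _
      _ ≤ (‖A‖ * ‖g x - g y‖) * (‖g x‖ + ‖g y‖) := by
          gcongr
          · exact A.le_opNorm _
          · exact norm_add_le _ _
      _ ≤ (‖A‖ * dist (∫ τ in a..x, ‖r τ‖) (∫ τ in a..y, ‖r τ‖)) * (M + M) := by gcongr
      _ = _ := by ring
  have hsub : uIcc s t ⊆ uIcc a b := uIcc_subset_uIcc hs ht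
  rw [← (hqac.mono hsub).integral_deriv_eq_sub, ← intervalIntegral.integral_const_mul]
  refine intervalIntegral.integral_congr_ae ?_
  filter_upwards [hr.ae_hasDerivAt_integral] with x hx hxst
  have hx' := hx (hsub (uIoc_subset_uIcc hxst)) a left_mem_uIcc
  have hgd : HasDerivAt g (r x) x := by
    have : g = fun t => c + ∫ τ in a..t, r τ := funext hg
    rw [this]
    exact hx'.const_add c
  have hq := (A.hasFDerivAt.comp_hasDerivAt x hgd).inner ℝ hgd
  have h5 : inner ℝ (A (r x)) (g x) = inner ℝ (A (g x)) (r x) := by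
    rw [real_inner_comm]; exact (hA _ _).symm
  have hq' := hq.deriv
  simp only [Function.comp_def] at hq'
  rw [hq', h5]
  ring

/-- The du Bois-Reymond lemma: if `r` is the weak derivative of `h`, then `h` is almost everywhere
a primitive of `r`. -/
lemma ae_eq_primitive [CompleteSpace E] {h r : ℝ → E} {a b : ℝ} (hab : a < b)
    (hh : IntegrableOn h (Icc a b)) (hr : IntegrableOn r (Icc a b))
    (H : ∀ φ : ℝ → ℝ, ContDiff ℝ ∞ φ → HasCompactSupport φ → tsupport φ ⊆ Ioo a b → ∀ v : E,
      ∫ t in Icc a b, deriv φ t * inner ℝ (h t) v = -∫ t in Icc a b, φ t * inner ℝ (r t) v) :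
    ∃ c : E, ∀ᵐ t ∂volume.restrict (Icc a b), h t = c + ∫ τ in a..t, r τ := by
  have hri : IntervalIntegrable r volume a b :=
    (intervalIntegrable_iff_integrableOn_Icc_of_le hab.le).2 hr
  have hGc : ContinuousOn (fun t => ∫ τ in a..t, r τ) (Icc a b) := by
    have := intervalIntegral.continuousOn_primitive_interval (a := a) (b := b) (f := r)
      (μ := volume) (by rwa [uIcc_of_le hab.le])
    rwa [uIcc_of_le hab.le] at this
  have hGi : IntegrableOn (fun t => ∫ τ in a..t, r τ) (Icc a b) :=
    hGc.integrableOn_compact isCompact_Icc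
  set D : ℝ → E := fun t => h t - ∫ τ in a..t, r τ with hD
  have hDi : IntegrableOn D (Icc a b) := hh.sub hGi
  have hsmul : ∀ φ : ℝ → ℝ, Continuous φ → ∀ k : ℝ → E, IntegrableOn k (Icc a b) →
      IntegrableOn (fun t => φ t • k t) (Icc a b) := fun φ hφ k hk =>
    hk.continuousOn_smul hφ.continuousOn isCompact_Icc
  -- `D` annihilates all derivatives of test functions
  have hD0 : ∀ φ : ℝ → ℝ, ContDiff ℝ ∞ φ → HasCompactSupport φ → tsupport φ ⊆ Ioo a b →
      ∫ t in Icc a b, deriv φ t • D t = 0 := by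
    intro φ hφ hφc hφs
    have hφ' : Continuous (deriv φ) := hφ.continuous_deriv (by simp)
    refine ext_inner_left ℝ fun v => ?_
    rw [inner_zero_right, ← integral_inner (hsmul _ hφ' _ hDi)]
    have hz : ∀ x, x ∉ Ioo a b → φ x = 0 := fun x hx => image_eq_zero_of_notMem_tsupport
      fun h => hx (hφs h)
    have hrv : IntervalIntegrable (fun τ => inner ℝ v (r τ)) volume a b :=
      ⟨hri.1.const_inner v, hri.2.const_inner v⟩
    have hGv : AbsolutelyContinuousOnInterval (fun t => ∫ τ in a..t, inner ℝ v (r τ)) a b :=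
      hrv.absolutelyContinuousOnInterval_intervalIntegral left_mem_uIcc
    have hφac : AbsolutelyContinuousOnInterval φ a b :=
      ((hφ.of_le (by simp)).contDiffOn).absolutelyContinuousOnInterval
    have hparts := hφac.integral_mul_deriv_eq_deriv_mul hGv
    rw [hz a (by simp), hz b (by simp)] at hparts
    have hd : ∫ x in a..b, φ x * deriv (fun t => ∫ τ in a..t, inner ℝ v (r τ)) x =
        ∫ x in a..b, φ x * inner ℝ v (r x) := by
      refine intervalIntegral.integral_congr_ae ?_
      filter_upwards [hrv.ae_hasDerivAt_integral] with x hx hxab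
      rw [(hx (uIoc_subset_uIcc hxab) a left_mem_uIcc).deriv]
    rw [hd] at hparts
    simp only [zero_mul, sub_zero, intervalIntegral.integral_of_le hab.le,
      ← integral_Icc_eq_integral_Ioc] at hparts
    have hHv := H φ hφ hφc hφs v
    have hG : ∀ t ∈ Icc a b, ∫ τ in a..t, inner ℝ v (r τ) = inner ℝ v (∫ τ in a..t, r τ) := by
      intro t ht
      rw [intervalIntegral.integral_of_le ht.1, intervalIntegral.integral_of_le ht.1]
      exact integral_inner (hr.mono_set (Ioc_subset_Icc_self.trans (Icc_subset_Icc_right ht.2))) v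
    have hG' : ∫ t in Icc a b, deriv φ t * ∫ τ in a..t, inner ℝ v (r τ) =
        ∫ t in Icc a b, inner ℝ v (deriv φ t • ∫ τ in a..t, r τ) :=
      setIntegral_congr_fun measurableSet_Icc fun t ht => by
        simp only [hG t ht, inner_smul_right]
    rw [hG'] at hparts
    have hH' : ∫ t in Icc a b, deriv φ t * inner ℝ (h t) v =
        ∫ t in Icc a b, inner ℝ v (deriv φ t • h t) := by
      simp only [inner_smul_right, real_inner_comm]
    rw [hH'] at hHv
    simp only [real_inner_comm v] at hHv
    have : ∫ t in Icc a b, inner ℝ v (deriv φ t • D t) =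
        (∫ t in Icc a b, inner ℝ v (deriv φ t • h t)) -
          ∫ t in Icc a b, inner ℝ v (deriv φ t • ∫ τ in a..t, r τ) := by
      rw [← integral_sub]
      · simp only [hD, smul_sub, inner_sub_right]
      · exact (hsmul _ hφ' _ hh).const_inner v
      · exact (hsmul _ hφ' _ hGi).const_inner v
    rw [this, hHv]
    linarith
  -- a fixed bump function of integral one
  let bump : ContDiffBump ((a + b) / 2) :=
    ⟨(b - a) / 8, (b - a) / 4, by linarith, by linarith⟩
  set φ₀ : ℝ → ℝ := bump.normed volume with hφ₀
  have hφ₀d : ContDiff ℝ ∞ φ₀ := bump.contDiff_normed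
  have hφ₀c : HasCompactSupport φ₀ := bump.hasCompactSupport_normed
  have hφ₀s : tsupport φ₀ ⊆ Ioo a b := by
    rw [hφ₀, bump.tsupport_normed_eq, Real.closedBall_eq_Icc]
    intro x hx
    change x ∈ Icc ((a + b) / 2 - (b - a) / 4) ((a + b) / 2 + (b - a) / 4) at hx
    exact ⟨by linarith [hx.1], by linarith [hx.2]⟩
  have hφ₀1 : ∫ x, φ₀ x = 1 := bump.integral_normed
  set c : E := ∫ t in Icc a b, φ₀ t • D t with hc
  have hset : ∀ ψ : ℝ → ℝ, tsupport ψ ⊆ Ioo a b → ∀ k : ℝ → E,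
      ∫ t, ψ t • k t = ∫ t in Icc a b, ψ t • k t := by
    intro ψ hψ k
    refine (setIntegral_eq_integral_of_forall_compl_eq_zero fun x hx => ?_).symm
    rw [image_eq_zero_of_notMem_tsupport fun h => hx (Ioo_subset_Icc_self (hψ h)), zero_smul]
  have key : ∀ ψ : ℝ → ℝ, ContDiff ℝ ∞ ψ → HasCompactSupport ψ → tsupport ψ ⊆ Ioo a b →
      ∫ t, ψ t • (D t - c) = 0 := by
    intro ψ hψ hψc hψs
    set m : ℝ := ∫ x, ψ x with hm
    set χ : ℝ → ℝ := fun t => ψ t - m * φ₀ t with hχ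
    have hχd : ContDiff ℝ ∞ χ := hψ.sub (contDiff_const.mul hφ₀d)
    have hK : IsCompact (tsupport ψ ∪ tsupport φ₀) := hψc.isCompact.union hφ₀c.isCompact
    have hKne : (tsupport ψ ∪ tsupport φ₀).Nonempty := by
      refine Set.Nonempty.inr ?_
      rw [hφ₀, bump.tsupport_normed_eq]
      exact ⟨_, Metric.mem_closedBall_self bump.rOut_pos.le⟩
    have hKs : tsupport ψ ∪ tsupport φ₀ ⊆ Ioo a b := union_subset hψs hφ₀s
    obtain ⟨a', ha', ha'l⟩ := hK.exists_isLeast hKne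
    obtain ⟨b', hb', hb'l⟩ := hK.exists_isGreatest hKne
    have hχ0 : ∀ x, x ∉ Icc a' b' → χ x = 0 := by
      intro x hx
      have h1 : ψ x = 0 := image_eq_zero_of_notMem_tsupport fun h =>
        hx ⟨ha'l (Or.inl h), hb'l (Or.inl h)⟩
      have h2 : φ₀ x = 0 := image_eq_zero_of_notMem_tsupport fun h =>
        hx ⟨ha'l (Or.inr h), hb'l (Or.inr h)⟩
      simp only [hχ, h1, h2]
      ring
    have hχi : ∫ x, χ x = 0 := by
      simp only [hχ]
      rw [integral_sub (hψ.continuous.integrable_of_hasCompactSupport hψc)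
        ((hφ₀d.continuous.integrable_of_hasCompactSupport hφ₀c).const_mul m),
        integral_const_mul, hφ₀1]
      simp [hm]
    set Φ : ℝ → ℝ := fun t => ∫ τ in a..t, χ τ with hΦ
    have hΦd : ∀ t, HasDerivAt Φ (χ t) t := fun t =>
      hχd.continuous.integral_hasStrictDerivAt a t |>.hasDerivAt
    have hΦ' : deriv Φ = χ := funext fun t => (hΦd t).deriv
    have hΦs : ContDiff ℝ ∞ Φ := by
      rw [contDiff_infty_iff_deriv, hΦ']
      exact ⟨fun t => (hΦd t).differentiableAt, hχd⟩
    have hΦ0 : ∀ t, t ∉ Icc a' b' → Φ t = 0 := by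
      intro t ht
      by_cases hta : t < a'
      · refine intervalIntegral.integral_zero_ae (.of_forall fun x hx => hχ0 x fun hx' => ?_)
        have := (uIoc_subset_uIcc hx).2
        have h3 : max a t < a' := max_lt (hKs ha').1 hta
        exact absurd hx'.1 (not_le.2 (this.trans_lt h3))
      · have htb : b' < t := by
          by_contra h
          exact ht ⟨not_lt.1 hta, not_lt.1 h⟩
        have hat : a ≤ t := ((hKs hb').1.trans htb).le
        rw [← hχi]
        simp only [hΦ]
        rw [intervalIntegral.integral_of_le hat, ← integral_Icc_eq_integral_Ioc]
        refine setIntegral_eq_integral_of_forall_compl_eq_zero fun x hx => hχ0 x fun hx' => ?_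
        exact hx ⟨(hKs ha').1.le.trans hx'.1, hx'.2.trans htb.le⟩
    have hΦsupp : tsupport Φ ⊆ Icc a' b' :=
      closure_minimal (fun x hx => by
        by_contra h
        exact hx (hΦ0 x h)) isClosed_Icc
    have hΦc : HasCompactSupport Φ := isCompact_Icc.of_isClosed_subset (isClosed_tsupport _) hΦsupp
    have h0 := hD0 Φ hΦs hΦc (hΦsupp.trans (Icc_subset_Ioo (hKs ha').1 (hKs hb').2))
    rw [hΦ'] at h0
    have h1 : ∫ t in Icc a b, χ t • D t = (∫ t in Icc a b, ψ t • D t) - m • c := by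
      rw [hc, ← integral_smul, ← integral_sub (hsmul _ hψ.continuous _ hDi)]
      · simp only [hχ, sub_smul, mul_smul]
      · exact (hsmul _ hφ₀d.continuous _ hDi).smul m
    rw [hset ψ hψs]
    simp only [smul_sub]
    rw [integral_sub (hsmul _ hψ.continuous _ hDi) (hsmul _ hψ.continuous _ (by simp)),
      ← hset ψ hψs (fun _ => c), integral_smul_const, ← hm, ← h1, h0]
  refine ⟨c, ?_⟩
  have hae := isOpen_Ioo.ae_eq_zero_of_integral_contDiff_smul_eq_zero (μ := volume)
    (f := fun t => D t - c) (U := Ioo a b)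
    (((hDi.mono_set Ioo_subset_Icc_self).sub (by simp)).locallyIntegrableOn) key
  rw [← restrict_Ioo_eq_restrict_Icc, ae_restrict_iff' measurableSet_Ioo]
  filter_upwards [hae] with t ht htab
  have := ht htab
  simp only [hD] at this
  rw [sub_sub, sub_eq_zero] at this
  rw [this]
  abel

end AbsCont

section Contraction

variable {E F : Type*} [NormedAddCommGroup E] [InnerProductSpace ℝ E] [CompleteSpace E]
  [NormedAddCommGroup F] [InnerProductSpace ℝ F] [CompleteSpace F]

/-- The operator `1 - J*J`, a nonnegative contraction if `‖J‖ ≤ 1`. -/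
noncomputable def defect (J : E →L[ℝ] F) : E →L[ℝ] E := 1 - J.adjoint ∘L J

lemma inner_adjoint_comp (J : E →L[ℝ] F) (x y : E) :
    inner ℝ ((J.adjoint ∘L J) x) y = inner ℝ (J x) (J y) := by
  simp [ContinuousLinearMap.adjoint_inner_left]

lemma norm_defect_sq_le {J : E →L[ℝ] F} (hJ : ‖J‖ ≤ 1) (x : E) :
    ‖defect J x‖ ^ 2 ≤ ‖x‖ ^ 2 - ‖J x‖ ^ 2 := by
  have h1 : ‖(J.adjoint ∘L J) x‖ ≤ ‖J x‖ := by
    have := J.adjoint.le_opNorm (J x)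
    rw [LinearIsometryEquiv.norm_map] at this
    exact this.trans (mul_le_of_le_one_left (norm_nonneg _) hJ)
  have h2 : inner ℝ x ((J.adjoint ∘L J) x) = ‖J x‖ ^ 2 := by
    rw [real_inner_comm, inner_adjoint_comp, real_inner_self_eq_norm_sq]
  have h3 : defect J x = x - (J.adjoint ∘L J) x := rfl
  rw [h3, norm_sub_sq_real, h2]
  nlinarith [norm_nonneg ((J.adjoint ∘L J) x), norm_nonneg (J x)]

lemma norm_defect_le {J : E →L[ℝ] F} (hJ : ‖J‖ ≤ 1) (x : E) : ‖defect J x‖ ≤ ‖x‖ := by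
  have := norm_defect_sq_le hJ x
  exact le_of_sq_le_sq (by nlinarith [sq_nonneg ‖J x‖]) (norm_nonneg _)

lemma norm_defect_pow_le {J : E →L[ℝ] F} (hJ : ‖J‖ ≤ 1) (n : ℕ) (x : E) :
    ‖(defect J ^ n) x‖ ≤ ‖x‖ := by
  induction n with
  | zero => simp
  | succ n ih =>
    rw [pow_succ', mul_apply_eq_comp]
    exact (norm_defect_le hJ _).trans ih

/-- The norms decrease along the iterates of `1 - J*J` by at least `‖J x‖²` in each step, so that the
values of `J` on the iterates are square summable. -/
lemma tendsto_apply_defect_pow {J : E →L[ℝ] F} (hJ : ‖J‖ ≤ 1) (x : E) :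
    Tendsto (fun n => J ((defect J ^ n) x)) atTop (𝓝 0) := by
  have hs : Summable fun n => ‖J ((defect J ^ n) x)‖ ^ 2 := by
    refine summable_of_sum_range_le (c := ‖x‖ ^ 2) (fun _ => by positivity) fun n => ?_
    have : ∀ n, ∑ i ∈ Finset.range n, ‖J ((defect J ^ i) x)‖ ^ 2 ≤
        ‖x‖ ^ 2 - ‖(defect J ^ n) x‖ ^ 2 := by
      intro n
      induction n with
      | zero => simp
      | succ n ih =>
        rw [Finset.sum_range_succ, pow_succ' (defect J), mul_apply_eq_comp]
        linarith [norm_defect_sq_le hJ ((defect J ^ n) x)]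
    linarith [this n, sq_nonneg ‖(defect J ^ n) x‖]
  have := hs.tendsto_atTop_zero.sqrt
  simp only [Real.sqrt_sq (norm_nonneg _), Real.sqrt_zero] at this
  exact tendsto_zero_iff_norm_tendsto_zero.2 this

lemma isSymmetric_adjoint_comp (J : E →L[ℝ] F) : (J.adjoint ∘L J).IsSymmetric := by
  intro x y
  change inner ℝ ((J.adjoint ∘L J) x) y = inner ℝ x ((J.adjoint ∘L J) y)
  rw [inner_adjoint_comp, real_inner_comm, ← inner_adjoint_comp, real_inner_comm]

/-- The iterates of `1 - J*J` tend strongly to zero if `J` is injective. -/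
lemma tendsto_defect_pow {J : E →L[ℝ] F} (hJ : ‖J‖ ≤ 1) (hinj : Function.Injective J) (x : E) :
    Tendsto (fun n => (defect J ^ n) x) atTop (𝓝 0) := by
  have hcomm : ∀ n : ℕ, ∀ y, (defect J ^ n) ((J.adjoint ∘L J) y) =
      J.adjoint (J ((defect J ^ n) y)) := by
    intro n y
    have h : Commute (defect J ^ n) (J.adjoint ∘L J) := by
      refine Commute.pow_left ?_ n
      exact (Commute.one_left _).sub_left (Commute.refl _)
    exact congrArg (fun L : E →L[ℝ] E => L y) h.eq
  -- the range of the self-adjoint operator `J*J` is dense because its kernel is trivial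
  have hdense : Dense (range (J.adjoint ∘L J)) := by
    have hT : (LinearMap.range ((J.adjoint ∘L J : E →L[ℝ] E) : E →ₗ[ℝ] E)).topologicalClosure = ⊤ := by
      rw [Submodule.topologicalClosure_eq_top_iff, Submodule.eq_bot_iff]
      intro y hy
      rw [Submodule.mem_orthogonal] at hy
      have h0 := hy ((J.adjoint ∘L J) y) ⟨y, rfl⟩
      rw [inner_adjoint_comp, inner_self_eq_zero] at h0
      exact hinj (by simpa using h0)
    exact Submodule.dense_iff_topologicalClosure_eq_top.2 hT
  rw [Metric.tendsto_atTop]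
  intro ε hε
  obtain ⟨_, hy, y, rfl⟩ := Metric.dense_iff.1 hdense x (ε / 2) (by positivity)
  have h1 : Tendsto (fun n => (defect J ^ n) ((J.adjoint ∘L J) y)) atTop (𝓝 0) := by
    simp_rw [hcomm]
    have := (J.adjoint.continuous.tendsto 0).comp (tendsto_apply_defect_pow hJ y)
    rwa [map_zero] at this
  obtain ⟨N, hN⟩ := Metric.tendsto_atTop.1 h1 (ε / 2) (by positivity)
  refine ⟨N, fun n hn => ?_⟩
  have h2 := hN n hn
  rw [dist_zero_right] at h2 ⊢
  rw [Metric.mem_ball, dist_eq_norm] at hy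
  have h3 := norm_defect_pow_le hJ n (x - (J.adjoint ∘L J) y)
  rw [norm_sub_rev] at hy
  calc ‖(defect J ^ n) x‖ = ‖(defect J ^ n) (x - (J.adjoint ∘L J) y) +
        (defect J ^ n) ((J.adjoint ∘L J) y)‖ := by rw [← map_add, sub_add_cancel]
    _ ≤ _ := norm_add_le _ _
    _ < ε := by linarith

lemma geom_sum_defect_mul (J : E →L[ℝ] F) (n : ℕ) :
    (∑ k ∈ Finset.range n, defect J ^ k) * (J.adjoint ∘L J) = 1 - defect J ^ n := by
  rw [← geom_sum_mul_neg]
  simp [defect]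

lemma isSymmetric_defect_pow (J : E →L[ℝ] F) (n : ℕ) : (defect J ^ n).IsSymmetric := by
  have h : IsSelfAdjoint (defect J) :=
    (IsSelfAdjoint.one _).sub
      (ContinuousLinearMap.isSelfAdjoint_iff_isSymmetric.2 (isSymmetric_adjoint_comp J))
  exact (h.pow n).isSymmetric

lemma isSymmetric_geom_sum_defect (J : E →L[ℝ] F) (n : ℕ) :
    (∑ k ∈ Finset.range n, defect J ^ k).IsSymmetric := by
  intro x y
  simp only [ContinuousLinearMap.coe_coe, sum_apply, sum_inner, inner_sum]
  exact Finset.sum_congr rfl fun k _ => isSymmetric_defect_pow J k x y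

/-- Energy identity for the regularisation `Q g` of a trajectory `u` with `J*J u = g` almost
everywhere: since `Q J*J = P`, the regularised trajectory is `P u` almost everywhere. -/
lemma norm_sq_regularized_sub {J : E →L[ℝ] F} {u r : ℝ → E} {a b : ℝ}
    (hr : IntervalIntegrable r volume a b) {g : ℝ → E} (c : E)
    (hg : ∀ t, g t = c + ∫ τ in a..t, r τ)
    (hug : ∀ᵐ t, t ∈ uIcc a b → (J.adjoint ∘L J) (u t) = g t)
    {Q P : E →L[ℝ] E} (hQ : Q.IsSymmetric) (hP : Q * (J.adjoint ∘L J) = P)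
    {s t : ℝ} (hs : s ∈ uIcc a b) (ht : t ∈ uIcc a b) :
    ‖J (Q (g t))‖ ^ 2 - ‖J (Q (g s))‖ ^ 2 = 2 * ∫ τ in s..t, inner ℝ (P (P (u τ))) (r τ) := by
  have hT := isSymmetric_adjoint_comp J
  have hA : (Q * (J.adjoint ∘L J) * Q).IsSymmetric := by
    intro x y
    exact ((hQ _ _).trans (hT _ _)).trans (hQ _ _)
  have hn : ∀ x, ‖J (Q x)‖ ^ 2 = inner ℝ ((Q * (J.adjoint ∘L J) * Q) x) x := by
    intro x
    rw [← real_inner_self_eq_norm_sq, ← inner_adjoint_comp]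
    exact (hQ ((J.adjoint ∘L J) (Q x)) x).symm
  rw [hn, hn, inner_primitive_sub hA hr c hg hs ht]
  congr 1
  refine intervalIntegral.integral_congr_ae ?_
  filter_upwards [hug] with x hx hxst
  rw [← hx ((uIcc_subset_uIcc hs ht) (uIoc_subset_uIcc hxst)), ← hP]
  rfl

/-- The Lions–Magenes theorem for the evolution triple given by an injective contraction
`J : E → F`. The hypothesis says that `r` represents the weak time derivative of `J u` in the dual of
`E` through the Riesz isomorphism. -/
theorem exists_continuous_representative {J : E →L[ℝ] F} (hJ : ‖J‖ ≤ 1)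
    (hinj : Function.Injective J) {u r : ℝ → E} {a b : ℝ} (hab : a < b)
    (hu : MemLp u 2 (volume.restrict (Icc a b))) (hr : MemLp r 2 (volume.restrict (Icc a b)))
    (H : ∀ φ : ℝ → ℝ, ContDiff ℝ ∞ φ → HasCompactSupport φ → tsupport φ ⊆ Ioo a b → ∀ v : E,
      ∫ t in Icc a b, deriv φ t * inner ℝ (J (u t)) (J v) =
        -∫ t in Icc a b, φ t * inner ℝ (r t) v) :
    ∃ e : ℝ → F, ContinuousOn e (Icc a b) ∧
      (∀ᵐ t ∂volume.restrict (Icc a b), e t = J (u t)) ∧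
      ∀ s ∈ Icc a b, ∀ t ∈ Icc a b,
        ‖e t‖ ^ 2 - ‖e s‖ ^ 2 = 2 * ∫ τ in s..t, inner ℝ (u τ) (r τ) := by
  have hri : IntegrableOn r (Icc a b) := hr.integrable (by norm_num)
  have hui : IntegrableOn u (Icc a b) := hu.integrable (by norm_num)
  have hrI : IntervalIntegrable r volume a b :=
    (intervalIntegrable_iff_integrableOn_Icc_of_le hab.le).2 hri
  obtain ⟨c, hc⟩ := ae_eq_primitive (h := fun t => (J.adjoint ∘L J) (u t)) hab
    ((J.adjoint ∘L J).integrable_comp hui) hri (by simpa only [inner_adjoint_comp] using H)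
  set g : ℝ → E := fun t => c + ∫ τ in a..t, r τ with hg
  have hgc : ContinuousOn g (Icc a b) := by
    have := intervalIntegral.continuousOn_primitive_interval (a := a) (b := b) (f := r)
      (μ := volume) (by rwa [uIcc_of_le hab.le])
    rw [uIcc_of_le hab.le] at this
    exact continuousOn_const.add this
  have hug : ∀ᵐ t, t ∈ uIcc a b → (J.adjoint ∘L J) (u t) = g t := by
    rw [uIcc_of_le hab.le]
    exact (ae_restrict_iff' measurableSet_Icc).1 hc
  set C := defect J with hC
  set S : ℕ → E →L[ℝ] E := fun n => ∑ k ∈ Finset.range n, C ^ k with hS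
  have hST : ∀ n, S n * (J.adjoint ∘L J) = 1 - C ^ n := geom_sum_defect_mul J
  have hSg : ∀ n t, (J.adjoint ∘L J) (u t) = g t → S n (g t) = u t - (C ^ n) (u t) := by
    intro n t ht
    rw [← ht]
    exact congrArg (fun L : E →L[ℝ] E => L (u t)) (hST n)
  have hSsymm : ∀ n, (S n).IsSymmetric := isSymmetric_geom_sum_defect J
  have hur : Integrable (fun t => ‖u t‖ * ‖r t‖) (volume.restrict (Icc a b)) :=
    hu.norm.integrable_mul hr.norm
  set I : ℕ → ℝ := fun n => ∫ t in Icc a b, ‖(C ^ n) (u t)‖ * ‖r t‖ with hI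
  have hmeas : ∀ L : E →L[ℝ] E, AEStronglyMeasurable (fun t => L (u t))
      (volume.restrict (Icc a b)) := fun L => L.continuous.comp_aestronglyMeasurable hu.1
  have hIint : ∀ n, Integrable (fun t => ‖(C ^ n) (u t)‖ * ‖r t‖) (volume.restrict (Icc a b)) := by
    intro n
    refine hur.mono' ((hmeas _).norm.mul hr.1.norm) (.of_forall fun t => ?_)
    rw [Real.norm_of_nonneg (by positivity)]
    gcongr
    exact norm_defect_pow_le hJ n _
  have hI0 : Tendsto I atTop (𝓝 0) := by
    have : Tendsto I atTop (𝓝 (∫ _ in Icc a b, (0 : ℝ))) := by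
      refine tendsto_integral_of_dominated_convergence (fun t => ‖u t‖ * ‖r t‖)
        (fun n => (hIint n).1) hur (fun n => .of_forall fun t => ?_) (.of_forall fun t => ?_)
      · rw [Real.norm_of_nonneg (by positivity)]
        gcongr
        exact norm_defect_pow_le hJ n _
      · simpa using (tendsto_defect_pow hJ hinj (u t)).norm.mul_const ‖r t‖
    simpa using this
  obtain ⟨s₀, hs₀, hs₀'⟩ : ∃ s, (J.adjoint ∘L J) (u s) = g s ∧ s ∈ Icc a b := by
    have : NeBot (ae (volume.restrict (Icc a b))) := by
      rw [ae_neBot]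
      simp [Measure.restrict_eq_zero, hab]
    exact (hc.and (ae_restrict_mem measurableSet_Icc)).exists
  -- The regularised trajectories are uniformly Cauchy: their difference is small at `s₀`, and by the
  -- energy identity it stays small, since `S m - S n` applied to `J*J u` is `C ^ n u - C ^ m u`.
  have hcauchy : UniformCauchySeqOn (fun n t => J (S n (g t))) atTop (Icc a b) := by
    rw [Metric.uniformCauchySeqOn_iff]
    intro ε hε
    have h1 : ∀ᶠ n in atTop, ‖(C ^ n) (u s₀)‖ < ε / 4 := by
      have := (tendsto_defect_pow hJ hinj (u s₀)).norm
      rw [norm_zero] at this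
      exact this.eventually_lt_const (by positivity)
    have h2 : ∀ᶠ n in atTop, I n < ε ^ 2 / 16 := hI0.eventually_lt_const (by positivity)
    obtain ⟨N, hN⟩ := eventually_atTop.1 (h1.and h2)
    refine ⟨N, fun m hm n hn t ht => ?_⟩
    obtain ⟨hm1, hm2⟩ := hN m hm
    obtain ⟨hn1, hn2⟩ := hN n hn
    have hQ : (S m - S n).IsSymmetric := by
      intro x y
      have h1 := hSsymm m x y
      have h2 := hSsymm n x y
      simp only [ContinuousLinearMap.coe_coe] at h1 h2
      simp only [ContinuousLinearMap.coe_coe, sub_apply, inner_sub_left,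
        inner_sub_right, h1, h2]
    have hP : (S m - S n) * (J.adjoint ∘L J) = C ^ n - C ^ m := by
      rw [sub_mul, hST, hST]
      abel
    have hen := norm_sq_regularized_sub (u := u) hrI c (fun _ => rfl) hug hQ hP
      (s := s₀) (t := t) (by rwa [uIcc_of_le hab.le]) (by rwa [uIcc_of_le hab.le])
    have hPn : ∀ x, ‖(C ^ n - C ^ m) x‖ ≤ ‖(C ^ n) x‖ + ‖(C ^ m) x‖ := fun x => norm_sub_le _ _
    have hPP : ∀ x, ‖(C ^ n - C ^ m) ((C ^ n - C ^ m) x)‖ ≤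
        2 * (‖(C ^ n) x‖ + ‖(C ^ m) x‖) := by
      intro x
      have h3 := hPn ((C ^ n - C ^ m) x)
      have h4 := norm_defect_pow_le hJ n ((C ^ n - C ^ m) x)
      have h5 := norm_defect_pow_le hJ m ((C ^ n - C ^ m) x)
      linarith [hPn x]
    have hint : |∫ τ in s₀..t, inner ℝ ((C ^ n - C ^ m) ((C ^ n - C ^ m) (u τ))) (r τ)| ≤
        2 * (I n + I m) := by
      have hb : Integrable (fun τ => 2 * (‖(C ^ n) (u τ)‖ * ‖r τ‖ + ‖(C ^ m) (u τ)‖ * ‖r τ‖))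
          (volume.restrict (Icc a b)) := ((hIint n).add (hIint m)).const_mul 2
      have hsub : uIoc s₀ t ⊆ Icc a b := by
        rw [← uIcc_of_le hab.le]
        exact uIoc_subset_uIcc.trans (uIcc_subset_uIcc (by rwa [uIcc_of_le hab.le])
          (by rwa [uIcc_of_le hab.le]))
      rw [← Real.norm_eq_abs, intervalIntegral.norm_integral_eq_norm_integral_uIoc]
      calc ‖∫ τ in uIoc s₀ t, inner ℝ ((C ^ n - C ^ m) ((C ^ n - C ^ m) (u τ))) (r τ)‖
          ≤ ∫ τ in uIoc s₀ t, 2 * (‖(C ^ n) (u τ)‖ * ‖r τ‖ + ‖(C ^ m) (u τ)‖ * ‖r τ‖) := by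
            refine norm_integral_le_of_norm_le (hb.mono_measure (Measure.restrict_mono_set _ hsub))
              (.of_forall fun τ => ?_)
            refine (norm_inner_le_norm _ _).trans ?_
            calc _ ≤ 2 * (‖(C ^ n) (u τ)‖ + ‖(C ^ m) (u τ)‖) * ‖r τ‖ := by
                  gcongr
                  exact hPP _
              _ = _ := by ring
        _ ≤ ∫ τ in Icc a b, 2 * (‖(C ^ n) (u τ)‖ * ‖r τ‖ + ‖(C ^ m) (u τ)‖ * ‖r τ‖) :=
            setIntegral_mono_set hb (.of_forall fun τ => by
              simp only [Pi.zero_apply]; positivity) hsub.eventuallyLE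
        _ = 2 * (I n + I m) := by
            rw [integral_const_mul, integral_add (hIint n) (hIint m)]
    have hstart : ‖J ((S m - S n) (g s₀))‖ ≤ ‖(C ^ n) (u s₀)‖ + ‖(C ^ m) (u s₀)‖ := by
      have h6 : (S m - S n) (g s₀) = (C ^ n - C ^ m) (u s₀) := by
        rw [sub_apply, hSg m s₀ hs₀, hSg n s₀ hs₀,
          sub_apply]
        abel
      rw [h6]
      refine le_trans ?_ (hPn (u s₀))
      exact (J.le_opNorm _).trans (mul_le_of_le_one_left (norm_nonneg _) hJ)
    rw [dist_eq_norm, ← map_sub, ← sub_apply]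
    have h7 := abs_le.1 hint
    refine lt_of_pow_lt_pow_left₀ 2 hε.le ?_
    have h8 : ‖J ((S m - S n) (g s₀))‖ ^ 2 ≤ (ε / 4 + ε / 4) ^ 2 := by
      gcongr
      linarith
    nlinarith
  have hex : ∀ t ∈ Icc a b, ∃ y, Tendsto (fun n => J (S n (g t))) atTop (𝓝 y) :=
    fun t ht => cauchySeq_tendsto_of_complete (hcauchy.cauchySeq ht)
  choose! e he using hex
  have hunif := hcauchy.tendstoUniformlyOn_of_tendsto he
  refine ⟨e, hunif.continuousOn (.of_forall fun n =>
    (J.continuous.comp (S n).continuous).comp_continuousOn hgc), ?_, ?_⟩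
  · filter_upwards [hc, ae_restrict_mem measurableSet_Icc] with t ht htab
    refine tendsto_nhds_unique (he t htab) ?_
    have h1 : (fun n => J (S n (g t))) = fun n => J (u t - (C ^ n) (u t)) := by
      funext n
      rw [hSg n t ht]
    rw [h1]
    have h2 := (tendsto_defect_pow hJ hinj (u t)).const_sub (u t)
    rw [sub_zero] at h2
    exact (J.continuous.tendsto _).comp h2
  · intro s hs t ht
    have hs' : s ∈ uIcc a b := by rwa [uIcc_of_le hab.le]
    have ht' : t ∈ uIcc a b := by rwa [uIcc_of_le hab.le]
    have hsub : uIoc s t ⊆ Icc a b := by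
      rw [← uIcc_of_le hab.le]
      exact uIoc_subset_uIcc.trans (uIcc_subset_uIcc hs' ht')
    have hlim : Tendsto (fun n => 2 * ∫ τ in s..t,
        inner ℝ ((1 - C ^ n : E →L[ℝ] E) ((1 - C ^ n : E →L[ℝ] E) (u τ))) (r τ)) atTop
        (𝓝 (2 * ∫ τ in s..t, inner ℝ (u τ) (r τ))) := by
      refine Tendsto.const_mul 2 ?_
      refine intervalIntegral.tendsto_integral_filter_of_dominated_convergence
        (fun τ => 4 * (‖u τ‖ * ‖r τ‖)) (.of_forall fun n => ?_) (.of_forall fun n => ?_) ?_ ?_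
      · exact ((hmeas ((1 - C ^ n) * (1 - C ^ n))).inner hr.1).mono_measure
          (Measure.restrict_mono_set _ hsub)
      · refine .of_forall fun τ _ => (norm_inner_le_norm _ _).trans ?_
        have hb : ∀ x, ‖(1 - C ^ n) x‖ ≤ 2 * ‖x‖ := by
          intro x
          have h3 : ‖(1 - C ^ n) x‖ ≤ ‖x‖ + ‖(C ^ n) x‖ := norm_sub_le _ _
          linarith [norm_defect_pow_le hJ n x]
        rw [← mul_assoc]
        gcongr
        linarith [hb ((1 - C ^ n) (u τ)), hb (u τ)]
      · rw [intervalIntegrable_iff]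
        exact (hur.mono_measure (Measure.restrict_mono_set _ hsub)).const_mul 4
      · refine .of_forall fun τ _ => Tendsto.inner ?_ tendsto_const_nhds
        have h1 := tendsto_defect_pow hJ hinj (u τ)
        have h2 : Tendsto (fun n => (C ^ n) ((C ^ n) (u τ))) atTop (𝓝 0) :=
          squeeze_zero_norm (fun n => norm_defect_pow_le hJ n _)
            (tendsto_zero_iff_norm_tendsto_zero.1 h1)
        have h3 := (((tendsto_const_nhds (x := u τ)).sub h1).sub h1).add h2
        simp only [sub_zero, add_zero] at h3
        refine h3.congr fun n => ?_
        simp only [sub_apply, one_apply_eq_self, map_sub]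
        abel
    refine tendsto_nhds_unique (((he t ht).norm.pow 2).sub ((he s hs).norm.pow 2)) ?_
    refine hlim.congr fun n => ?_
    exact (norm_sq_regularized_sub (u := u) hrI c (fun _ => rfl) hug (hSsymm n) (hST n)
      hs' ht').symm

end Contraction

/-! ### Fourier series and Ladyzhenskaya's inequality on the torus -/

/-- The complex Hilbert space `L²(𝕋²; ℂ)`. -/
abbrev L2C : Type := Lp ℂ 2 torusMeasure

/-- The character `exp (2 π i k · x)` as an element of `L²(𝕋²; ℂ)`. -/
noncomputable def expLp (k : Fin 2 → ℤ) : L2C :=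
  ContinuousMap.toLp (E := ℂ) 2 torusMeasure ℂ (mFourier k)

lemma mFourierCoeff_eq_inner (f : L2C) (k : Fin 2 → ℤ) :
    mFourierCoeff f k = inner ℂ (expLp k) f := by
  have h := mFourierBasis_repr (d := Fin 2) f k
  rw [← h, HilbertBasis.repr_apply_apply, coe_mFourierBasis]
  rfl

lemma hasSum_coeff_smul_expLp (f : L2C) : HasSum (fun k => mFourierCoeff f k • expLp k) f :=
  hasSum_mFourier_series_L2 (d := Fin 2) f

lemma hasSum_coeff_sq (f : L2C) : HasSum (fun k => ‖mFourierCoeff f k‖ ^ 2) (‖f‖ ^ 2) := by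
  have h := hasSum_sq_mFourierCoeff (d := Fin 2) f
  have h2 : ‖f‖ ^ 2 = ∫ t, ‖f t‖ ^ 2 ∂torusMeasure := by
    rw [← inner_self_eq_norm_sq (𝕜 := ℂ) f, MeasureTheory.L2.inner_def,
      ← integral_re (L2.integrable_inner f f)]
    simp only [inner_self_eq_norm_sq]
  rw [h2]
  exact h

lemma hasSum_coeff_mul (f g : L2C) :
    HasSum (fun k => (starRingEnd ℂ) (mFourierCoeff f k) * mFourierCoeff g k)
      (∫ x, (starRingEnd ℂ) (f x) * g x ∂torusMeasure) :=
  hasSum_prod_mFourierCoeff (d := Fin 2) f g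

/-- `g` is the weak gradient of the scalar function `f`, in terms of Fourier coefficients as in
`IsWeakGradient`. -/
def HasWeakGrad (f : L2C) (g : Fin 2 → L2C) : Prop :=
  ∀ j k, mFourierCoeff (g j) k = (2 * Real.pi * Complex.I * (k j : ℂ)) * mFourierCoeff f k

lemma HasWeakGrad.sub {f f' : L2C} {g g' : Fin 2 → L2C} (h : HasWeakGrad f g)
    (h' : HasWeakGrad f' g') : HasWeakGrad (f - f') (g - g') := by
  intro j k
  have h1 := h j k
  have h2 := h' j k
  rw [mFourierCoeff_eq_inner] at h1 h2 ⊢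
  rw [mFourierCoeff_eq_inner] at h1 h2 ⊢
  rw [Pi.sub_apply, inner_sub_right, inner_sub_right, h1, h2]
  ring

/-- The trigonometric polynomial with frequencies in `S` and coefficients `c`. -/
noncomputable def trig (S : Finset (Fin 2 → ℤ)) (c : (Fin 2 → ℤ) → ℂ) : C(Torus, ℂ) :=
  ∑ k ∈ S, c k • (mFourier k : C(Torus, ℂ))

lemma trig_apply (S : Finset (Fin 2 → ℤ)) (c : (Fin 2 → ℤ) → ℂ) (x : Torus) :
    trig S c x = ∑ k ∈ S, c k * mFourier k x := by
  simp [trig]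

/-- The trigonometric polynomial `trig S c` as an element of `L²(𝕋²; ℂ)`. -/
noncomputable def trigLp (S : Finset (Fin 2 → ℤ)) (c : (Fin 2 → ℤ) → ℂ) : L2C :=
  ContinuousMap.toLp (E := ℂ) 2 torusMeasure ℂ (trig S c)

lemma coeFn_trigLp (S : Finset (Fin 2 → ℤ)) (c : (Fin 2 → ℤ) → ℂ) :
    trigLp S c =ᵐ[torusMeasure] trig S c :=
  ContinuousMap.coeFn_toLp torusMeasure _

lemma trigLp_eq_sum (S : Finset (Fin 2 → ℤ)) (c : (Fin 2 → ℤ) → ℂ) :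
    trigLp S c = ∑ k ∈ S, c k • expLp k := by
  simp [trigLp, trig, expLp]

lemma tendsto_trigLp (f : L2C) : Tendsto (fun S => trigLp S (mFourierCoeff f)) atTop (𝓝 f) := by
  simp only [trigLp_eq_sum]
  exact hasSum_coeff_smul_expLp f

lemma orthonormal_expLp : Orthonormal ℂ expLp := orthonormal_mFourier (d := Fin 2)

/-- Truncation of Fourier series commutes with the weak gradient. -/
lemma hasWeakGrad_trigLp {f : L2C} {g : Fin 2 → L2C} (h : HasWeakGrad f g)
    (S : Finset (Fin 2 → ℤ)) :
    HasWeakGrad (trigLp S (mFourierCoeff f)) (fun j => trigLp S (mFourierCoeff (g j))) := by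
  classical
  intro j k
  have hc : ∀ c : (Fin 2 → ℤ) → ℂ, mFourierCoeff (trigLp S c) k = if k ∈ S then c k else 0 := by
    intro c
    rw [mFourierCoeff_eq_inner, trigLp_eq_sum, inner_sum]
    simp only [inner_smul_right, orthonormal_iff_ite.1 orthonormal_expLp]
    simp
  rw [hc, hc, h j k]
  split_ifs <;> simp

/-- On the circle, `|q(y)|²` is at most its mean plus the total variation of `|q|²`. -/
lemma enorm_sq_le_lintegral_circle {q q' : AddCircle (1 : ℝ) → ℂ} (hq : Continuous q)
    (hq' : Continuous q') (hd : ∀ s : ℝ, HasDerivAt (fun t : ℝ => q t) (q' s) s)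
    (y : AddCircle (1 : ℝ)) :
    ‖q y‖ₑ ^ 2 ≤ ∫⁻ z, (‖q z‖ₑ ^ 2 + 2 * ‖q z‖ₑ * ‖q' z‖ₑ) ∂AddCircle.haarAddCircle := by
  have hvol : (volume : Measure (AddCircle (1 : ℝ))) = AddCircle.haarAddCircle := by
    rw [AddCircle.volume_eq_smul_haarAddCircle]
    simp
  have hcont : Continuous fun t : ℝ => q (t : AddCircle (1 : ℝ)) :=
    hq.comp (AddCircle.continuous_mk' 1)
  have hcont' : Continuous fun t : ℝ => q' (t : AddCircle (1 : ℝ)) :=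
    hq'.comp (AddCircle.continuous_mk' 1)
  set F : AddCircle (1 : ℝ) → ℝ := fun z => ‖q z‖ ^ 2 + 2 * ‖q z‖ * ‖q' z‖ with hF
  have hFc : Continuous F := by fun_prop
  have hFi : Integrable F AddCircle.haarAddCircle := hFc.integrable_of_hasCompactSupport
    (HasCompactSupport.of_compactSpace _)
  have hreal : ‖q y‖ ^ 2 ≤ ∫ z, F z ∂AddCircle.haarAddCircle := by
    rw [← hvol, ← AddCircle.intervalIntegral_preimage 1 0 F]
    obtain ⟨s, hs, rfl⟩ : ∃ s : ℝ, s ∈ Icc (0 : ℝ) 1 ∧ (s : AddCircle (1 : ℝ)) = y := by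
      obtain ⟨s, hs, h⟩ := (AddCircle.coe_image_Icc_eq (1 : ℝ) 0 ▸ mem_univ y : y ∈ _)
      exact ⟨s, by simpa using hs, h⟩
    rw [zero_add]
    have hpt : ∀ t ∈ Icc (0 : ℝ) 1, ‖q s‖ ^ 2 ≤ ‖q t‖ ^ 2 +
        ∫ τ in (0 : ℝ)..1, 2 * ‖q τ‖ * ‖q' τ‖ := by
      intro t ht
      have hftc : ∫ τ in t..s, 2 * inner ℝ (q τ) (q' τ) = ‖q s‖ ^ 2 - ‖q t‖ ^ 2 := by
        refine intervalIntegral.integral_eq_sub_of_hasDerivAt (fun τ _ => (hd τ).norm_sq) ?_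
        exact Continuous.intervalIntegrable (by fun_prop) _ _
      have hle : |∫ τ in t..s, 2 * inner ℝ (q τ) (q' τ)| ≤
          ∫ τ in (0 : ℝ)..1, 2 * ‖q τ‖ * ‖q' τ‖ := by
        rw [← Real.norm_eq_abs, intervalIntegral.norm_integral_eq_norm_integral_uIoc,
          intervalIntegral.integral_of_le zero_le_one, ← integral_Icc_eq_integral_Ioc]
        have hsub : uIoc t s ⊆ Icc 0 1 := by
          rw [← uIcc_of_le (zero_le_one' ℝ)]
          exact uIoc_subset_uIcc.trans (uIcc_subset_uIcc (by rwa [uIcc_of_le zero_le_one])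
            (by rwa [uIcc_of_le zero_le_one]))
        have hb : IntegrableOn (fun τ : ℝ => 2 * ‖q τ‖ * ‖q' τ‖) (Icc 0 1) :=
          (by fun_prop : Continuous fun τ : ℝ => 2 * ‖q τ‖ * ‖q' τ‖).integrableOn_Icc
        refine (norm_integral_le_of_norm_le (hb.mono_set hsub) (.of_forall fun τ => ?_)).trans
          (setIntegral_mono_set hb (.of_forall fun τ => by
              simp only [Pi.zero_apply]; positivity) hsub.eventuallyLE)
        rw [norm_mul, Real.norm_two, mul_assoc]
        gcongr
        exact norm_inner_le_norm _ _
      have := (abs_le.1 hle).2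
      linarith
    have hmono := intervalIntegral.integral_mono_on (μ := volume) zero_le_one
      (f := fun _ : ℝ => ‖q s‖ ^ 2)
      (g := fun t : ℝ => ‖q t‖ ^ 2 + ∫ τ in (0 : ℝ)..1, 2 * ‖q τ‖ * ‖q' τ‖)
      (by simp) (Continuous.intervalIntegrable (by fun_prop) _ _) hpt
    rw [intervalIntegral.integral_add (Continuous.intervalIntegrable (by fun_prop) _ _) (by simp)]
      at hmono
    simp only [intervalIntegral.integral_const, sub_zero, one_smul] at hmono
    rwa [← intervalIntegral.integral_add (Continuous.intervalIntegrable (by fun_prop) _ _)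
      (Continuous.intervalIntegrable (by fun_prop) _ _)] at hmono
  have h := ENNReal.ofReal_le_ofReal hreal
  rw [ofReal_integral_eq_lintegral_ofReal hFi (.of_forall fun z => by
    simp only [hF, Pi.zero_apply]; positivity)] at h
  have he : ∀ z, ENNReal.ofReal (F z) = ‖q z‖ₑ ^ 2 + 2 * ‖q z‖ₑ * ‖q' z‖ₑ := by
    intro z
    simp only [hF]
    rw [ENNReal.ofReal_add (by positivity) (by positivity), ENNReal.ofReal_mul (by positivity),
      ENNReal.ofReal_mul (by positivity), ENNReal.ofReal_pow (norm_nonneg _), ofReal_norm,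
      ofReal_norm]
    simp
  simp only [he, ENNReal.ofReal_pow (norm_nonneg _), ofReal_norm] at h
  exact h

lemma mFourier_update (k : Fin 2 → ℤ) (x : Torus) (i : Fin 2) (t : AddCircle (1 : ℝ)) :
    mFourier k (Function.update x i t) =
      fourier (k i) t * mFourier k (Function.update x i 0) := by
  simp only [mFourier, ContinuousMap.coe_mk, Fin.prod_univ_two]
  fin_cases i
  · simp
  · simp [mul_comm]

lemma hasDerivAt_trig_update (S : Finset (Fin 2 → ℤ)) (c : (Fin 2 → ℤ) → ℂ) (x : Torus)
    (i : Fin 2) (s : ℝ) :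
    HasDerivAt (fun t : ℝ => trig S c (Function.update x i (t : AddCircle (1 : ℝ))))
      (trig S (fun k => 2 * Real.pi * Complex.I * (k i : ℂ) * c k)
        (Function.update x i (s : AddCircle (1 : ℝ)))) s := by
  simp only [trig_apply]
  refine HasDerivAt.fun_sum fun k _ => ?_
  have hu : (fun t : ℝ => c k * mFourier k (Function.update x i (t : AddCircle (1 : ℝ)))) =
      fun t : ℝ => c k * (fourier (k i) (t : AddCircle (1 : ℝ)) *
        mFourier k (Function.update x i 0)) :=
    funext fun t => by rw [mFourier_update k x i t]
  rw [hu, mFourier_update k x i s]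
  have := ((hasDerivAt_fourier 1 (k i) s).mul_const
    (mFourier k (Function.update x i 0))).const_mul (c k)
  refine this.congr_deriv ?_
  push_cast
  ring

/-- Ladyzhenskaya's inequality for trigonometric polynomials, from the one-dimensional bound along
both coordinate circles and Fubini's theorem in the form of the grid-lines lemma. -/
lemma lintegral_trig_pow_four_le (S : Finset (Fin 2 → ℤ)) (c : (Fin 2 → ℤ) → ℂ) :
    ∫⁻ x, ‖trig S c x‖ₑ ^ 4 ∂torusMeasure ≤
      (∫⁻ x, (‖trig S c x‖ₑ ^ 2 + 2 * ‖trig S c x‖ₑ *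
        (‖trig S (fun k => 2 * Real.pi * Complex.I * (k 0 : ℂ) * c k) x‖ₑ +
          ‖trig S (fun k => 2 * Real.pi * Complex.I * (k 1 : ℂ) * c k) x‖ₑ)) ∂torusMeasure) ^ 2 := by
  set F : Torus → ℝ≥0∞ := fun x => ‖trig S c x‖ₑ ^ 2 + 2 * ‖trig S c x‖ₑ *
        (‖trig S (fun k => 2 * Real.pi * Complex.I * (k 0 : ℂ) * c k) x‖ₑ +
          ‖trig S (fun k => 2 * Real.pi * Complex.I * (k 1 : ℂ) * c k) x‖ₑ) with hF
  have hFm : Measurable F := by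
    have hc (c' : (Fin 2 → ℤ) → ℂ) : Measurable fun x => ‖trig S c' x‖ₑ :=
      (trig S c').continuous.enorm.measurable
    exact ((hc _).pow_const 2).add (((hc _).const_mul 2).mul ((hc _).add (hc _)))
  have hgrid := lintegral_prod_lintegral_pow_le
    (fun _ : Fin 2 => (AddCircle.haarAddCircle : Measure (AddCircle (1 : ℝ)))) (p := 2)
    (by simpa using Real.HolderConjugate.two_two) hFm
  have h2 : ∀ y : ℝ≥0∞, y ^ (2 : ℝ) = y ^ 2 := fun y => by
    exact_mod_cast ENNReal.rpow_natCast y 2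
  rw [h2] at hgrid
  refine le_trans (lintegral_mono fun x => ?_) hgrid
  have hx : ∀ i : Fin 2, ‖trig S c x‖ₑ ^ 2 ≤
      ∫⁻ t, F (Function.update x i t) ∂AddCircle.haarAddCircle := by
    intro i
    have hu : Continuous fun t : AddCircle (1 : ℝ) => Function.update x i t :=
      continuous_const.update i continuous_id
    have h1 := enorm_sq_le_lintegral_circle
      ((trig S c).continuous.comp hu)
      ((trig S (fun k => 2 * Real.pi * Complex.I * (k i : ℂ) * c k)).continuous.comp hu)
      (hasDerivAt_trig_update S c x i) (x i)
    simp only [Function.comp_apply, Function.update_eq_self] at h1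
    refine h1.trans (lintegral_mono fun t => ?_)
    simp only [hF]
    gcongr
    fin_cases i
    · exact le_self_add
    · exact le_add_self
  have h4 : ‖trig S c x‖ₑ ^ 4 = ‖trig S c x‖ₑ ^ 2 * ‖trig S c x‖ₑ ^ 2 := by ring
  rw [h4, Fin.prod_univ_two]
  norm_num
  exact mul_le_mul' (hx 0) (hx 1)

lemma lintegral_mul_enorm_le {f g : Torus → ℂ} (hf : AEStronglyMeasurable f torusMeasure)
    (hg : AEStronglyMeasurable g torusMeasure) :
    ∫⁻ x, ‖f x‖ₑ * ‖g x‖ₑ ∂torusMeasure ≤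
      eLpNorm f 2 torusMeasure * eLpNorm g 2 torusMeasure := by
  have h := ENNReal.lintegral_mul_le_Lp_mul_Lq torusMeasure Real.HolderConjugate.two_two
    hf.enorm hg.enorm
  simp only [Pi.mul_apply] at h
  rwa [eLpNorm_eq_lintegral_rpow_enorm_toReal (by norm_num) (by norm_num),
    eLpNorm_eq_lintegral_rpow_enorm_toReal (by norm_num) (by norm_num), ENNReal.toReal_ofNat]

/-- The bound for the `L⁴` norm of `f` in Ladyzhenskaya's inequality, where `g` is the gradient. -/
noncomputable def ladyBound (f : L2C) (g : Fin 2 → L2C) : ℝ :=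
  √(‖f‖ * (‖f‖ + 2 * (‖g 0‖ + ‖g 1‖)))

lemma eLpNorm_trigLp_le (S : Finset (Fin 2 → ℤ)) {f : L2C} {g : Fin 2 → L2C}
    (h : HasWeakGrad f g) :
    eLpNorm (trigLp S (mFourierCoeff f)) 4 torusMeasure ≤
      ENNReal.ofReal (ladyBound (trigLp S (mFourierCoeff f))
        fun j => trigLp S (mFourierCoeff (g j))) := by
  set c : (Fin 2 → ℤ) → ℂ := mFourierCoeff f with hc
  have hg : ∀ j, mFourierCoeff (g j) = fun k => 2 * Real.pi * Complex.I * (k j : ℂ) * c k :=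
    fun j => funext fun k => h j k
  have hm : ∀ c', AEStronglyMeasurable (trig S c') torusMeasure := fun c' =>
    (trig S c').continuous.aestronglyMeasurable
  have hn : ∀ c', eLpNorm (trig S c') 2 torusMeasure = ENNReal.ofReal ‖trigLp S c'‖ := by
    intro c'
    rw [ofReal_norm, Lp.enorm_def, eLpNorm_congr_ae (coeFn_trigLp S c')]
  have hmain : ∫⁻ x, ‖trig S c x‖ₑ ^ 4 ∂torusMeasure ≤
      ENNReal.ofReal (‖trigLp S c‖ * (‖trigLp S c‖ + 2 * (‖trigLp S (mFourierCoeff (g 0))‖ +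
        ‖trigLp S (mFourierCoeff (g 1))‖))) ^ 2 := by
    refine (lintegral_trig_pow_four_le S c).trans ?_
    rw [← hg 0, ← hg 1]
    refine pow_le_pow_left' ?_ 2
    have he : ∀ x, ‖trig S c x‖ₑ ^ 2 + 2 * ‖trig S c x‖ₑ *
        (‖trig S (mFourierCoeff (g 0)) x‖ₑ + ‖trig S (mFourierCoeff (g 1)) x‖ₑ) =
        ‖trig S c x‖ₑ * ‖trig S c x‖ₑ +
          (2 * (‖trig S c x‖ₑ * ‖trig S (mFourierCoeff (g 0)) x‖ₑ) +
            2 * (‖trig S c x‖ₑ * ‖trig S (mFourierCoeff (g 1)) x‖ₑ)) := fun x => by ring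
    have hmm : ∀ c' c'', Measurable fun x => ‖trig S c' x‖ₑ * ‖trig S c'' x‖ₑ := fun c' c'' =>
      ((trig S c').continuous.enorm.measurable).mul ((trig S c'').continuous.enorm.measurable)
    simp only [he]
    rw [lintegral_add_left (hmm _ _), lintegral_add_left ((hmm _ _).const_mul 2),
      lintegral_const_mul 2 (hmm _ _), lintegral_const_mul 2 (hmm _ _)]
    have e2 : ENNReal.ofReal 2 = 2 := by simp
    rw [ENNReal.ofReal_mul (by positivity), ENNReal.ofReal_add (by positivity) (by positivity),
      ENNReal.ofReal_mul (by positivity), ENNReal.ofReal_add (by positivity) (by positivity), e2,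
      mul_add, mul_add, mul_add, mul_left_comm _ 2, mul_left_comm _ 2]
    gcongr <;> simp only [← hn] <;> exact lintegral_mul_enorm_le (hm _) (hm _)
  rw [eLpNorm_congr_ae (coeFn_trigLp S c),
    eLpNorm_eq_lintegral_rpow_enorm_toReal (by norm_num) (by norm_num), ENNReal.toReal_ofNat]
  have h4 : ∀ y : ℝ≥0∞, y ^ (4 : ℝ) = y ^ 4 := fun y => by
    exact_mod_cast ENNReal.rpow_natCast y 4
  rw [one_div, ENNReal.rpow_inv_le_iff (by norm_num), h4]
  simp only [h4]
  refine hmain.trans (le_of_eq ?_)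
  rw [ladyBound, ← ENNReal.ofReal_pow (by positivity), ← ENNReal.ofReal_pow (by positivity)]
  congr 1
  rw [show (4 : ℕ) = 2 * 2 from rfl, pow_mul, Real.sq_sqrt (by positivity)]

/-- **Ladyzhenskaya's inequality** on the torus. -/
lemma eLpNorm_four_le {f : L2C} {g : Fin 2 → L2C} (h : HasWeakGrad f g) :
    eLpNorm f 4 torusMeasure ≤ ENNReal.ofReal (ladyBound f g) := by
  have ht := tendsto_trigLp f
  obtain ⟨ns, hns, hae⟩ := (tendstoInMeasure_of_tendsto_Lp ht).exists_seq_tendsto_ae'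
  have hlim := Lp.eLpNorm_lim_le_liminf_eLpNorm (p := 4)
    (fun n => (Lp.aestronglyMeasurable (trigLp (ns n) (mFourierCoeff f)))) f hae
  refine hlim.trans ?_
  have hb : Tendsto (fun n => ENNReal.ofReal (ladyBound (trigLp (ns n) (mFourierCoeff f))
        fun j => trigLp (ns n) (mFourierCoeff (g j)))) atTop (𝓝 (ENNReal.ofReal (ladyBound f g))) := by
    refine ENNReal.tendsto_ofReal ?_
    have h1 := (ht.comp hns).norm
    have h2 := fun j => ((tendsto_trigLp (g j)).comp hns).norm
    exact (h1.mul (h1.add (((h2 0).add (h2 1)).const_mul 2))).sqrt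
  rw [← hb.liminf_eq]
  exact liminf_le_liminf (.of_forall fun n => eLpNorm_trigLp_le (ns n) h)

lemma HasWeakGrad.memLp_four {f : L2C} {g : Fin 2 → L2C} (h : HasWeakGrad f g) :
    MemLp f 4 torusMeasure :=
  ⟨Lp.aestronglyMeasurable f, (eLpNorm_four_le h).trans_lt ENNReal.ofReal_lt_top⟩

/-! ### Hölder's inequality and the Leibniz rule against a divergence-free field -/

section Triple

variable {A B C : Type*} [NormedAddCommGroup A] [NormedAddCommGroup B] [NormedAddCommGroup C]

lemma eLpNorm_norm_mul_norm_le {a : Torus → A} {b : Torus → B} {p q r : ℝ≥0∞}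
    [ENNReal.HolderTriple p q r]
    (ha : AEStronglyMeasurable a torusMeasure) (hb : AEStronglyMeasurable b torusMeasure) :
    eLpNorm (fun x => ‖a x‖ * ‖b x‖) r torusMeasure ≤
      eLpNorm a p torusMeasure * eLpNorm b q torusMeasure := by
  have h := eLpNorm_smul_le_mul_eLpNorm (p := p) (q := q) (r := r) hb.norm ha.norm
  rwa [eLpNorm_norm, eLpNorm_norm] at h

lemma holderTriple_four_four_two : ENNReal.HolderTriple 4 4 2 := by
  refine ⟨?_⟩
  have h : (4 : ℝ≥0∞) = 2 * 2 := by norm_num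
  rw [h, ENNReal.mul_inv (by simp) (by simp), ← mul_add, ENNReal.inv_two_add_inv_two, mul_one]

/-- Hölder's inequality with exponents `4`, `4`, `2`. -/
lemma integrable_norm_mul_norm_mul_norm {a : Torus → A} {b : Torus → B} {c : Torus → C}
    (ha : MemLp a 4 torusMeasure) (hb : MemLp b 4 torusMeasure) (hc : MemLp c 2 torusMeasure) :
    Integrable (fun x => ‖a x‖ * ‖b x‖ * ‖c x‖) torusMeasure ∧
      ∫ x, ‖a x‖ * ‖b x‖ * ‖c x‖ ∂torusMeasure ≤
        (eLpNorm a 4 torusMeasure).toReal * (eLpNorm b 4 torusMeasure).toReal *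
          (eLpNorm c 2 torusMeasure).toReal := by
  have := holderTriple_four_four_two
  have hm : AEStronglyMeasurable (fun x => ‖a x‖ * ‖b x‖) torusMeasure := ha.1.norm.mul hb.1.norm
  have h1 := eLpNorm_norm_mul_norm_le (p := 4) (q := 4) (r := 2) ha.1 hb.1
  have h2 := eLpNorm_norm_mul_norm_le (p := 2) (q := 2) (r := 1) hm hc.1
  have h3 : eLpNorm (fun x => ‖a x‖ * ‖b x‖ * ‖c x‖) 1 torusMeasure ≤
      eLpNorm a 4 torusMeasure * eLpNorm b 4 torusMeasure * eLpNorm c 2 torusMeasure := by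
    have h4 : (fun x => ‖a x‖ * ‖b x‖ * ‖c x‖) = fun x => ‖‖a x‖ * ‖b x‖‖ * ‖c x‖ := by
      funext x
      rw [Real.norm_of_nonneg (by positivity)]
    rw [h4]
    exact h2.trans (mul_le_mul' h1 le_rfl)
  have hfin : eLpNorm a 4 torusMeasure * eLpNorm b 4 torusMeasure * eLpNorm c 2 torusMeasure < ⊤ :=
    ENNReal.mul_lt_top (ENNReal.mul_lt_top ha.2 hb.2) hc.2
  have hint : Integrable (fun x => ‖a x‖ * ‖b x‖ * ‖c x‖) torusMeasure :=
    memLp_one_iff_integrable.1 ⟨hm.mul hc.1.norm, h3.trans_lt hfin⟩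
  refine ⟨hint, ?_⟩
  have h5 : ∫ x, ‖a x‖ * ‖b x‖ * ‖c x‖ ∂torusMeasure =
      ∫ x, ‖‖a x‖ * ‖b x‖ * ‖c x‖‖ ∂torusMeasure :=
    integral_congr_ae (.of_forall fun x => (Real.norm_of_nonneg (by positivity)).symm)
  rw [h5, integral_norm_eq_lintegral_enorm hint.1, ← eLpNorm_one_eq_lintegral_enorm,
    ← ENNReal.toReal_mul, ← ENNReal.toReal_mul]
  exact ENNReal.toReal_mono hfin.ne h3

end Triple

lemma eLpNorm_two_toReal {E : Type*} [NormedAddCommGroup E] (f : Lp E 2 torusMeasure) :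
    (eLpNorm f 2 torusMeasure).toReal = ‖f‖ := (Lp.norm_def f).symm

/-- A divergence-free real field is orthogonal to weak gradients. Reality is needed because Parseval's
identity involves the complex conjugate of `z`. -/
lemma integral_mul_weakGrad_eq_zero {z : Fin 2 → L2C}
    (hreal : ∀ j, ∀ᵐ x ∂torusMeasure, (starRingEnd ℂ) (z j x) = z j x)
    (hdiv : ∀ k : Fin 2 → ℤ, ∑ j, (k j : ℂ) * mFourierCoeff (z j) k = 0)
    {h : L2C} {H : Fin 2 → L2C} (hH : HasWeakGrad h H) :
    ∫ x, ∑ j, z j x * H j x ∂torusMeasure = 0 := by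
  have hint : ∀ j, Integrable (fun x => z j x * H j x) torusMeasure := fun j =>
    (Lp.memLp (z j)).integrable_mul (Lp.memLp (H j))
  rw [integral_finsetSum _ fun j _ => hint j]
  have hs := hasSum_sum (s := Finset.univ) fun j _ => hasSum_coeff_mul (z j) (H j)
  have h0 : ∀ k, ∑ j, (starRingEnd ℂ) (mFourierCoeff (z j) k) * mFourierCoeff (H j) k = 0 := by
    intro k
    have hc := congrArg (starRingEnd ℂ) (hdiv k)
    simp only [map_sum, map_mul, map_intCast, map_zero] at hc
    simp only [hH _ k]
    calc _ = 2 * Real.pi * Complex.I * mFourierCoeff h k *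
          ∑ j, (k j : ℂ) * (starRingEnd ℂ) (mFourierCoeff (z j) k) := by
          rw [Finset.mul_sum]
          exact Finset.sum_congr rfl fun j _ => by ring
      _ = 0 := by rw [hc, mul_zero]
  simp only [h0] at hs
  rw [← hs.unique hasSum_zero]
  refine Finset.sum_congr rfl fun j _ => integral_congr_ae ?_
  filter_upwards [hreal j] with x hx
  rw [hx]

lemma memLp_mFourier_mul (m : Fin 2 → ℤ) (g : L2C) :
    MemLp (fun x => mFourier m x * g x) 2 torusMeasure := by
  refine (Lp.memLp g).of_le ((mFourier m).continuous.aestronglyMeasurable.mul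
    (Lp.aestronglyMeasurable g)) (.of_forall fun x => ?_)
  rw [norm_mul]
  exact mul_le_of_le_one_left (norm_nonneg _)
    (((mFourier m).norm_coe_le_norm x).trans mFourier_norm.le)

/-- The product of `g` with the character of frequency `m`. -/
noncomputable def mulExp (m : Fin 2 → ℤ) (g : L2C) : L2C := (memLp_mFourier_mul m g).toLp

lemma coeFn_mulExp (m : Fin 2 → ℤ) (g : L2C) :
    mulExp m g =ᵐ[torusMeasure] fun x => mFourier m x * g x :=
  (memLp_mFourier_mul m g).coeFn_toLp

lemma mFourierCoeff_mulExp (m : Fin 2 → ℤ) (g : L2C) (k : Fin 2 → ℤ) :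
    mFourierCoeff (mulExp m g) k = mFourierCoeff g (k - m) := by
  refine integral_congr_ae (μ := torusMeasure) ?_
  filter_upwards [coeFn_mulExp m g] with x hx
  rw [hx, smul_eq_mul, smul_eq_mul, ← mul_assoc, ← mFourier_add]
  congr 3
  abel

lemma hasWeakGrad_mulExp (m : Fin 2 → ℤ) {g : L2C} {g' : Fin 2 → L2C} (hg : HasWeakGrad g g') :
    HasWeakGrad (mulExp m g) fun j =>
      (2 * Real.pi * Complex.I * (m j : ℂ)) • mulExp m g + mulExp m (g' j) := by
  intro j k
  rw [mFourierCoeff_eq_inner (_ + _), inner_add_right, inner_smul_right, ← mFourierCoeff_eq_inner,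
    ← mFourierCoeff_eq_inner, mFourierCoeff_mulExp, mFourierCoeff_mulExp, hg j]
  push_cast [Pi.sub_apply]
  ring

/-- For a divergence-free real field `z` and scalar functions `f`, `g` with weak gradients, the
integral of `z · ∇(f g)`, expanded by the Leibniz rule, vanishes. The product `f g` itself need not
have a weak gradient in `L²`, which is why `f` is approximated by trigonometric polynomials. -/
lemma integral_transport_eq_zero {z : Fin 2 → L2C} (hz : ∀ j, MemLp (z j) 4 torusMeasure)
    (hreal : ∀ j, ∀ᵐ x ∂torusMeasure, (starRingEnd ℂ) (z j x) = z j x)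
    (hdiv : ∀ k : Fin 2 → ℤ, ∑ j, (k j : ℂ) * mFourierCoeff (z j) k = 0)
    {f g : L2C} {f' g' : Fin 2 → L2C} (hf : HasWeakGrad f f') (hg : HasWeakGrad g g') :
    ∫ x, ∑ j, z j x * (f' j x * g x + f x * g' j x) ∂torusMeasure = 0 := by
  -- `T F F'` is the integral with `F` in place of `f`, and `K F F'` is a bound for it.
  set T : L2C → (Fin 2 → L2C) → ℂ := fun F F' =>
    ∫ x, ∑ j, z j x * (F' j x * g x + F x * g' j x) ∂torusMeasure with hT
  have hg4 := hg.memLp_four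
  have hint : ∀ (F : L2C) (F' : Fin 2 → L2C), HasWeakGrad F F' → ∀ j,
      Integrable (fun x => z j x * (F' j x * g x + F x * g' j x)) torusMeasure ∧
      ‖∫ x, z j x * (F' j x * g x + F x * g' j x) ∂torusMeasure‖ ≤
        (eLpNorm (z j) 4 torusMeasure).toReal * (eLpNorm g 4 torusMeasure).toReal * ‖F' j‖ +
        (eLpNorm (z j) 4 torusMeasure).toReal * ladyBound F F' * ‖g' j‖ := by
    intro F F' hF j
    have h1 := integrable_norm_mul_norm_mul_norm (hz j) hg4 (Lp.memLp (F' j))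
    have h2 := integrable_norm_mul_norm_mul_norm (hz j) hF.memLp_four (Lp.memLp (g' j))
    have hle : ∀ x, ‖z j x * (F' j x * g x + F x * g' j x)‖ ≤
        ‖z j x‖ * ‖g x‖ * ‖F' j x‖ + ‖z j x‖ * ‖F x‖ * ‖g' j x‖ := by
      intro x
      rw [norm_mul]
      calc _ ≤ ‖z j x‖ * (‖F' j x * g x‖ + ‖F x * g' j x‖) := by
            gcongr
            exact norm_add_le _ _
        _ = _ := by rw [norm_mul, norm_mul]; ring
    have hm : AEStronglyMeasurable (fun x => z j x * (F' j x * g x + F x * g' j x)) torusMeasure :=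
      (Lp.aestronglyMeasurable (z j)).mul
        (((Lp.aestronglyMeasurable (F' j)).mul (Lp.aestronglyMeasurable g)).add
          ((Lp.aestronglyMeasurable F).mul (Lp.aestronglyMeasurable (g' j))))
    refine ⟨(h1.1.add h2.1).mono' hm (.of_forall hle), ?_⟩
    refine (norm_integral_le_of_norm_le (h1.1.add h2.1) (.of_forall hle)).trans ?_
    simp only [Pi.add_apply]
    rw [integral_add h1.1 h2.1]
    refine add_le_add (h1.2.trans (by rw [eLpNorm_two_toReal])) (h2.2.trans ?_)
    rw [eLpNorm_two_toReal]
    gcongr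
    exact ENNReal.toReal_le_of_le_ofReal (Real.sqrt_nonneg _) (eLpNorm_four_le hF)
  set K : (L2C) → (Fin 2 → L2C) → ℝ := fun F F' =>
    ∑ j, ((eLpNorm (z j) 4 torusMeasure).toReal * (eLpNorm g 4 torusMeasure).toReal * ‖F' j‖ +
        (eLpNorm (z j) 4 torusMeasure).toReal * ladyBound F F' * ‖g' j‖) with hK
  have hTK : ∀ (F : L2C) (F' : Fin 2 → L2C), HasWeakGrad F F' → ‖T F F'‖ ≤ K F F' := by
    intro F F' hF
    simp only [hT]
    rw [integral_finsetSum _ fun j _ => (hint F F' hF j).1]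
    exact (norm_sum_le _ _).trans (Finset.sum_le_sum fun j _ => (hint F F' hF j).2)
  -- For a character in place of `f`, the product with `g` has a weak gradient in `L²`.
  have hexp : ∀ m : Fin 2 → ℤ, ∫ x, ∑ j, z j x * ((2 * Real.pi * Complex.I * (m j : ℂ)) *
      mFourier m x * g x + mFourier m x * g' j x) ∂torusMeasure = 0 := by
    intro m
    rw [← integral_mul_weakGrad_eq_zero hreal hdiv (hasWeakGrad_mulExp m hg)]
    refine integral_congr_ae ?_
    have h1 : ∀ j, ∀ᵐ x ∂torusMeasure,
        ((2 * Real.pi * Complex.I * (m j : ℂ)) • mulExp m g + mulExp m (g' j) : L2C) x =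
        (2 * Real.pi * Complex.I * (m j : ℂ)) * mFourier m x * g x + mFourier m x * g' j x := by
      intro j
      filter_upwards [Lp.coeFn_add ((2 * Real.pi * Complex.I * (m j : ℂ)) • mulExp m g)
        (mulExp m (g' j)), Lp.coeFn_smul (2 * Real.pi * Complex.I * (m j : ℂ)) (mulExp m g),
        coeFn_mulExp m g, coeFn_mulExp m (g' j)] with x h1 h2 h3 h4
      rw [h1, Pi.add_apply, h2, Pi.smul_apply, h3, h4, smul_eq_mul]
      ring
    filter_upwards [ae_all_iff.2 h1] with x hx
    simp only [hx]
  have hintexp : ∀ m : Fin 2 → ℤ, Integrable (fun x => ∑ j, z j x *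
      ((2 * Real.pi * Complex.I * (m j : ℂ)) * mFourier m x * g x + mFourier m x * g' j x))
      torusMeasure := by
    intro m
    refine integrable_finsetSum _ fun j _ => ?_
    have h : MemLp (fun x => (2 * Real.pi * Complex.I * (m j : ℂ)) * (mFourier m x * g x) +
        mFourier m x * g' j x) 2 torusMeasure :=
      ((memLp_mFourier_mul m g).const_mul _).add (memLp_mFourier_mul m (g' j))
    simp only [← mul_assoc] at h
    exact (Lp.memLp (z j)).integrable_mul h
  have htrig : ∀ S : Finset (Fin 2 → ℤ), T (trigLp S (mFourierCoeff f))
      (fun j => trigLp S (mFourierCoeff (f' j))) = 0 := by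
    intro S
    have h1 : T (trigLp S (mFourierCoeff f)) (fun j => trigLp S (mFourierCoeff (f' j))) =
        ∫ x, ∑ m ∈ S, mFourierCoeff f m * ∑ j, z j x * ((2 * Real.pi * Complex.I * (m j : ℂ)) *
          mFourier m x * g x + mFourier m x * g' j x) ∂torusMeasure := by
      refine integral_congr_ae ?_
      filter_upwards [coeFn_trigLp S (mFourierCoeff f),
        ae_all_iff.2 fun j => coeFn_trigLp S (mFourierCoeff (f' j))] with x h1 h2
      simp only [h1, h2, trig_apply, hf _ _, Finset.mul_sum, Finset.sum_mul,
        ← Finset.sum_add_distrib]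
      rw [Finset.sum_comm]
      exact Finset.sum_congr rfl fun m _ => Finset.sum_congr rfl fun j _ => by ring
    rw [h1, integral_finsetSum _ fun m _ => (hintexp m).const_mul _]
    refine Finset.sum_eq_zero fun m _ => ?_
    rw [integral_const_mul, hexp, mul_zero]
  -- By linearity `T f f'` is the value of `T` at the tail of the Fourier series, for every truncation.
  have hbound : ∀ S : Finset (Fin 2 → ℤ), ‖T f f'‖ ≤
      K (f - trigLp S (mFourierCoeff f)) (f' - fun j => trigLp S (mFourierCoeff (f' j))) := by
    intro S
    have hS := hasWeakGrad_trigLp hf S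
    have h1 : T f f' - T (trigLp S (mFourierCoeff f))
        (fun j => trigLp S (mFourierCoeff (f' j))) =
        T (f - trigLp S (mFourierCoeff f)) (f' - fun j => trigLp S (mFourierCoeff (f' j))) := by
      simp only [hT]
      rw [← integral_sub (integrable_finsetSum _ fun j _ => (hint _ _ hf j).1)
        (integrable_finsetSum _ fun j _ => (hint _ _ hS j).1)]
      refine integral_congr_ae ?_
      filter_upwards [Lp.coeFn_sub f (trigLp S (mFourierCoeff f)), ae_all_iff.2 fun j =>
        Lp.coeFn_sub (f' j) (trigLp S (mFourierCoeff (f' j)))] with x h1 h2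
      simp only [Pi.sub_apply, h1, h2, ← Finset.sum_sub_distrib]
      exact Finset.sum_congr rfl fun j _ => by ring
    rw [htrig, sub_zero] at h1
    rw [h1]
    exact hTK _ _ (hf.sub hS)
  have hlim : Tendsto (fun S : Finset (Fin 2 → ℤ) =>
      K (f - trigLp S (mFourierCoeff f)) (f' - fun j => trigLp S (mFourierCoeff (f' j))))
      atTop (𝓝 0) := by
    have h1 : Tendsto (fun S => ‖f - trigLp S (mFourierCoeff f)‖) atTop (𝓝 0) := by
      simpa using ((tendsto_trigLp f).const_sub f).norm
    have h2 : ∀ j, Tendsto (fun S => ‖f' j - trigLp S (mFourierCoeff (f' j))‖) atTop (𝓝 0) := by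
      intro j
      simpa using ((tendsto_trigLp (f' j)).const_sub (f' j)).norm
    have h3 : Tendsto (fun S => ladyBound (f - trigLp S (mFourierCoeff f))
        (f' - fun j => trigLp S (mFourierCoeff (f' j)))) atTop (𝓝 0) := by
      have := (h1.mul (h1.add (((h2 0).add (h2 1)).const_mul 2))).sqrt
      simpa [ladyBound] using this
    have h4 := tendsto_finsetSum Finset.univ fun (j : Fin 2) _ =>
      ((h2 j).const_mul ((eLpNorm (z j) 4 torusMeasure).toReal *
        (eLpNorm g 4 torusMeasure).toReal)).add
      ((h3.const_mul (eLpNorm (z j) 4 torusMeasure).toReal).mul_const ‖g' j‖)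
    simpa [hK] using h4
  have h0 : ‖T f f'‖ ≤ 0 := ge_of_tendsto hlim (.of_forall hbound)
  exact norm_le_zero_iff.1 h0

/-! ### The space `V` and the convection form -/

section Components

variable {ι : Type} [Fintype ι]

/-- The `p`-th component of a real vector field, regarded as a complex-valued function. -/
noncomputable def component (p : ι) : Lp (EuclideanSpace ℝ ι) 2 torusMeasure →L[ℝ] L2C :=
  (Complex.ofRealCLM ∘L (EuclideanSpace.proj p : EuclideanSpace ℝ ι →L[ℝ] ℝ)).compLpL
    2 torusMeasure

lemma coeFn_component (p : ι) (w : Lp (EuclideanSpace ℝ ι) 2 torusMeasure) :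
    component p w =ᵐ[torusMeasure] fun x => ((w x p : ℝ) : ℂ) := by
  filter_upwards [ContinuousLinearMap.coeFn_compLpL (p := 2) (μ := torusMeasure)
    (Complex.ofRealCLM ∘L (EuclideanSpace.proj p : EuclideanSpace ℝ ι →L[ℝ] ℝ)) w] with x hx
  exact hx

lemma coeFn_component_all (w : Lp (EuclideanSpace ℝ ι) 2 torusMeasure) :
    ∀ᵐ x ∂torusMeasure, ∀ p, component p w x = ((w x p : ℝ) : ℂ) :=
  ae_all_iff.2 fun p => coeFn_component p w

lemma mFourierCoeff_component (p : ι) (w : Lp (EuclideanSpace ℝ ι) 2 torusMeasure)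
    (k : Fin 2 → ℤ) :
    mFourierCoeff (component p w) k = mFourierCoeff (fun x : Torus => ((w x p : ℝ) : ℂ)) k := by
  refine integral_congr_ae (μ := torusMeasure) ?_
  filter_upwards [coeFn_component p w] with x hx
  rw [hx]

lemma norm_sq_eq_integral {E : Type*} [NormedAddCommGroup E] (w : Lp E 2 torusMeasure) :
    ‖w‖ ^ 2 = ∫ x, ‖w x‖ ^ 2 ∂torusMeasure := by
  rw [Lp.norm_def, eLpNorm_eq_lintegral_rpow_enorm_toReal (by norm_num) (by norm_num),
    ENNReal.toReal_ofNat, one_div, ← ENNReal.toReal_pow]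
  have h2 : ∀ y : ℝ≥0∞, y ^ (2 : ℝ) = y ^ 2 := fun y => by
    exact_mod_cast ENNReal.rpow_natCast y 2
  rw [← ENNReal.rpow_natCast, ← ENNReal.rpow_mul]
  norm_num
  rw [integral_eq_lintegral_of_nonneg_ae (.of_forall fun x => by positivity)
    ((continuous_pow 2).comp_aestronglyMeasurable (Lp.aestronglyMeasurable w).norm)]
  congr 1
  refine lintegral_congr fun x => ?_
  rw [ENNReal.ofReal_pow (norm_nonneg _), ofReal_norm]

lemma norm_sq_eq_sum_component (w : Lp (EuclideanSpace ℝ ι) 2 torusMeasure) :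
    ‖w‖ ^ 2 = ∑ p, ‖component p w‖ ^ 2 := by
  simp only [norm_sq_eq_integral]
  rw [← integral_finsetSum _ fun p _ => (Lp.memLp (component p w)).integrable_norm_pow (by simp)]
  refine integral_congr_ae ?_
  filter_upwards [coeFn_component_all w] with x hx
  simp only [hx, Complex.norm_real]
  exact EuclideanSpace.norm_sq_eq _

lemma norm_component_le (p : ι) (w : Lp (EuclideanSpace ℝ ι) 2 torusMeasure) :
    ‖component p w‖ ≤ ‖w‖ := by
  refine le_of_sq_le_sq ?_ (norm_nonneg _)
  rw [norm_sq_eq_sum_component w]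
  exact Finset.single_le_sum (f := fun p => ‖component p w‖ ^ 2) (fun _ _ => by positivity)
    (Finset.mem_univ p)

lemma eq_zero_of_mFourierCoeff_eq_zero {f : L2C} (h : ∀ k, mFourierCoeff f k = 0) : f = 0 := by
  have := hasSum_coeff_sq f
  simp only [h, norm_zero, ne_eq, OfNat.ofNat_ne_zero, not_false_eq_true, zero_pow] at this
  have h0 := this.unique hasSum_zero
  simpa using h0

end Components

lemma norm_sq_eq (v : V) : ‖v‖ ^ 2 = ‖vel v‖ ^ 2 + ‖grad v‖ ^ 2 :=
  WithLp.prod_norm_sq_eq_of_L2 (v : WithLp 2 (L2Vec × L2Mat))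

lemma norm_vel_le (v : V) : ‖vel v‖ ≤ ‖v‖ :=
  le_of_sq_le_sq (by nlinarith [norm_sq_eq v, sq_nonneg ‖grad v‖]) (norm_nonneg _)

lemma norm_grad_le (v : V) : ‖grad v‖ ≤ ‖v‖ :=
  le_of_sq_le_sq (by nlinarith [norm_sq_eq v, sq_nonneg ‖vel v‖]) (norm_nonneg _)

/-- The inclusion of `V` into `L²` as a bounded operator. -/
noncomputable def velL : V →L[ℝ] L2Vec :=
  LinearMap.mkContinuous ⟨⟨vel, fun _ _ => rfl⟩, fun _ _ => rfl⟩ 1 fun v => by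
    rw [one_mul]; exact norm_vel_le v

/-- The gradient as a bounded operator. -/
noncomputable def gradL : V →L[ℝ] L2Mat :=
  LinearMap.mkContinuous ⟨⟨grad, fun _ _ => rfl⟩, fun _ _ => rfl⟩ 1 fun v => by
    rw [one_mul]; exact norm_grad_le v

lemma velL_apply (v : V) : velL v = vel v := rfl

lemma norm_velL_le : ‖velL‖ ≤ 1 := LinearMap.mkContinuous_norm_le _ zero_le_one _

lemma hasWeakGrad_component (v : V) (i : Fin 2) :
    HasWeakGrad (component i (vel v)) fun j => component (i, j) (grad v) := by
  intro j k
  rw [mFourierCoeff_component, mFourierCoeff_component]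
  exact v.2.1 i j k

lemma component_trace_eq_zero_iff (G : L2Mat) :
    component (0, 0) G + component (1, 1) G = 0 ↔
      ∀ᵐ x ∂torusMeasure, G x (0, 0) + G x (1, 1) = 0 := by
  have h : ∀ᵐ x ∂torusMeasure, (component (0, 0) G + component (1, 1) G : L2C) x =
      ((G x (0, 0) + G x (1, 1) : ℝ) : ℂ) := by
    filter_upwards [Lp.coeFn_add (component (0, 0) G) (component (1, 1) G),
      coeFn_component_all G] with x h1 h2
    rw [h1, Pi.add_apply, h2, h2]
    push_cast
    rfl
  rw [Lp.eq_zero_iff_ae_eq_zero]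
  constructor
  · intro h0
    filter_upwards [h, h0] with x h1 h2
    rw [h1] at h2
    exact Complex.ofReal_eq_zero.1 h2
  · intro h0
    filter_upwards [h, h0] with x h1 h2
    rw [h1, h2]
    rfl

lemma trace_grad (v : V) : ∀ᵐ x ∂torusMeasure, grad v x (0, 0) + grad v x (1, 1) = 0 := v.2.2

lemma sum_coeff_vel_eq_zero (v : V) (k : Fin 2 → ℤ) :
    ∑ j, (k j : ℂ) * mFourierCoeff (component j (vel v)) k = 0 := by
  have h0 := (component_trace_eq_zero_iff (grad v)).2 (trace_grad v)
  have h1 : mFourierCoeff (component (0, 0) (grad v)) k +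
      mFourierCoeff (component (1, 1) (grad v)) k = 0 := by
    rw [mFourierCoeff_eq_inner, mFourierCoeff_eq_inner, ← inner_add_right, h0, inner_zero_right]
  rw [hasWeakGrad_component v 0 0 k, hasWeakGrad_component v 1 1 k, mul_assoc, mul_assoc (2 * _ * _),
    ← mul_add] at h1
  rw [Fin.sum_univ_two]
  exact (mul_eq_zero.1 h1).resolve_left Complex.two_pi_I_ne_zero

/-- `V` is complete: membership is given by equations between continuous functions on a Hilbert
space. -/
instance : CompleteSpace V := by
  have hf : Continuous fun w : WithLp 2 (L2Vec × L2Mat) => w.fst :=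
    continuous_fst.comp (WithLp.prod_continuous_ofLp 2 _ _)
  have hs : Continuous fun w : WithLp 2 (L2Vec × L2Mat) => w.snd :=
    continuous_snd.comp (WithLp.prod_continuous_ofLp 2 _ _)
  have hV : (V : Set (WithLp 2 (L2Vec × L2Mat))) =
      (⋂ (i : Fin 2) (j : Fin 2) (k : Fin 2 → ℤ), {w | inner ℂ (expLp k) (component (i, j) w.snd) =
        (2 * Real.pi * Complex.I * (k j : ℂ)) * inner ℂ (expLp k) (component i w.fst)}) ∩
      {w | component (0, 0) w.snd + component (1, 1) w.snd = 0} := by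
    ext w
    simp only [mem_inter_iff, mem_iInter, mem_ofPred_eq, component_trace_eq_zero_iff,
      ← mFourierCoeff_eq_inner, mFourierCoeff_component]
    rfl
  have hclosed : IsClosed (V : Set (WithLp 2 (L2Vec × L2Mat))) := by
    rw [hV]
    refine IsClosed.inter (isClosed_iInter fun i => isClosed_iInter fun j => isClosed_iInter
      fun k => isClosed_eq ?_ ?_) (isClosed_eq ?_ continuous_const)
    · exact continuous_const.inner ((component (i, j)).continuous.comp hs)
    · exact continuous_const.mul (continuous_const.inner ((component i).continuous.comp hf))
    · exact ((component _).continuous.comp hs).add ((component _).continuous.comp hs)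
  exact hclosed.completeSpace_coe

/-- The weak gradient is determined by the velocity, so that `V` embeds into `L²`. -/
lemma vel_injective : Function.Injective velL := by
  refine (injective_iff_map_eq_zero _).2 fun v hv => ?_
  rw [velL_apply] at hv
  have h : ∀ p : Fin 2 × Fin 2, component p (grad v) = 0 := by
    rintro ⟨i, j⟩
    refine eq_zero_of_mFourierCoeff_eq_zero fun k => ?_
    have h1 := hasWeakGrad_component v i j k
    have h2 : mFourierCoeff (component i (vel v)) k = 0 := by
      rw [hv, map_zero, mFourierCoeff_eq_inner, inner_zero_right]
    rw [h1, h2, mul_zero]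
  have h2 := norm_sq_eq_sum_component (grad v)
  simp only [h, norm_zero] at h2
  have h3 := norm_sq_eq v
  rw [h2, hv] at h3
  simpa using h3

/-- Poincaré's inequality for mean-zero fields. The optimal constant is `4 π²`, of which only
`π > 3` is used. -/
lemma norm_vel_sq_le {v : V} (hv : ∫ x, vel v x ∂torusMeasure = 0) :
    36 * ‖vel v‖ ^ 2 ≤ ‖grad v‖ ^ 2 := by
  have h0 : ∀ i, mFourierCoeff (component i (vel v)) 0 = 0 := by
    intro i
    have h1 : mFourierCoeff (component i (vel v)) 0 =
        ∫ x, ((vel v x i : ℝ) : ℂ) ∂torusMeasure := by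
      refine integral_congr_ae (μ := torusMeasure) ?_
      filter_upwards [coeFn_component i (vel v)] with x hx
      rw [hx, neg_zero, mFourier_zero]
      simp
    have hint : Integrable (fun x => vel v x) torusMeasure :=
      (Lp.memLp (vel v)).integrable (by norm_num)
    have h2 : ∫ x, vel v x i ∂torusMeasure = (∫ x, vel v x ∂torusMeasure) i :=
      (EuclideanSpace.proj i : Vec →L[ℝ] ℝ).integral_comp_comm hint
    rw [h1, integral_complex_ofReal, h2, hv]
    simp
  have hi : ∀ i, 36 * ‖component i (vel v)‖ ^ 2 ≤ ∑ j, ‖component (i, j) (grad v)‖ ^ 2 := by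
    intro i
    refine hasSum_le (fun k => ?_) ((hasSum_coeff_sq (component i (vel v))).mul_left 36)
      (hasSum_sum (s := Finset.univ) fun j _ => hasSum_coeff_sq (component (i, j) (grad v)))
    have h3 : ∀ j, ‖mFourierCoeff (component (i, j) (grad v)) k‖ ^ 2 =
        (4 * Real.pi ^ 2) * (k j : ℝ) ^ 2 * ‖mFourierCoeff (component i (vel v)) k‖ ^ 2 := by
      intro j
      rw [hasWeakGrad_component v i j k]
      simp only [norm_mul, Complex.norm_real, Complex.norm_I, Complex.norm_intCast,
        Complex.norm_two, Real.norm_of_nonneg Real.pi_pos.le, mul_pow, sq_abs]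
      ring
    simp only [h3]
    rw [← Finset.sum_mul, ← Finset.mul_sum, Fin.sum_univ_two]
    by_cases hk : k = 0
    · rw [hk, h0]; simp
    · have h4 : (1 : ℝ) ≤ (k 0 : ℝ) ^ 2 + (k 1 : ℝ) ^ 2 := by
        have h5 : k 0 ≠ 0 ∨ k 1 ≠ 0 := by
          by_contra! h
          exact hk (funext fun j => by fin_cases j; exacts [h.1, h.2])
        have h6 : 1 ≤ (k 0) ^ 2 + (k 1) ^ 2 := by
          rcases h5 with h | h
          · nlinarith [Int.one_le_abs h, sq_abs (k 0), sq_nonneg (k 1), abs_nonneg (k 0)]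
          · nlinarith [Int.one_le_abs h, sq_abs (k 1), sq_nonneg (k 0), abs_nonneg (k 1)]
        exact_mod_cast h6
      gcongr
      nlinarith [Real.pi_gt_three]
  rw [norm_sq_eq_sum_component (vel v), norm_sq_eq_sum_component (grad v), Finset.mul_sum,
    Fintype.sum_prod_type]
  exact Finset.sum_le_sum fun i _ => hi i

/-- The `L⁴` norm of the velocity. It is finite by `memLp_vel_four`. -/
noncomputable def normFour (v : V) : ℝ := (eLpNorm (vel v) 4 torusMeasure).toReal

lemma normFour_nonneg (v : V) : 0 ≤ normFour v := ENNReal.toReal_nonneg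

lemma eLpNorm_vel_le (v : V) : eLpNorm (vel v) 4 torusMeasure ≤
    ENNReal.ofReal (2 * √(5 * ‖vel v‖ * ‖v‖)) := by
  have h1 : ∀ᵐ x ∂torusMeasure, ‖vel v x‖ ≤
      ‖‖component 0 (vel v) x‖ + ‖component 1 (vel v) x‖‖ := by
    filter_upwards [coeFn_component_all (vel v)] with x hx
    rw [Real.norm_of_nonneg (by positivity)]
    refine le_of_sq_le_sq ?_ (by positivity)
    rw [EuclideanSpace.norm_sq_eq, Fin.sum_univ_two, hx, hx, Complex.norm_real, Complex.norm_real]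
    nlinarith [mul_nonneg (norm_nonneg (vel v x 0)) (norm_nonneg (vel v x 1))]
  have h2 : ∀ i : Fin 2, eLpNorm (component i (vel v)) 4 torusMeasure ≤
      ENNReal.ofReal (√(5 * ‖vel v‖ * ‖v‖)) := by
    intro i
    refine (eLpNorm_four_le (hasWeakGrad_component v i)).trans (ENNReal.ofReal_le_ofReal ?_)
    refine Real.sqrt_le_sqrt ?_
    have h3 := norm_component_le i (vel v)
    have h4 := norm_component_le (i, (0 : Fin 2)) (grad v)
    have h5 := norm_component_le (i, (1 : Fin 2)) (grad v)
    have h6 := norm_vel_le v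
    have h7 := norm_grad_le v
    calc _ ≤ ‖vel v‖ * (‖v‖ + 2 * (‖v‖ + ‖v‖)) := by
          gcongr <;> linarith
      _ = _ := by ring
  refine (eLpNorm_mono_ae h1).trans ?_
  refine (eLpNorm_add_le (Lp.aestronglyMeasurable _).norm (Lp.aestronglyMeasurable _).norm
    (by norm_num)).trans ?_
  rw [eLpNorm_norm, eLpNorm_norm, two_mul, ENNReal.ofReal_add (by positivity) (by positivity)]
  exact add_le_add (h2 0) (h2 1)

lemma memLp_vel_four (v : V) : MemLp (vel v) 4 torusMeasure :=
  ⟨Lp.aestronglyMeasurable _, (eLpNorm_vel_le v).trans_lt ENNReal.ofReal_lt_top⟩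

/-- Ladyzhenskaya's inequality on `V`. -/
lemma normFour_sq_le (v : V) : normFour v ^ 2 ≤ 20 * (‖vel v‖ * ‖v‖) := by
  have h : normFour v ≤ 2 * √(5 * ‖vel v‖ * ‖v‖) :=
    ENNReal.toReal_le_of_le_ofReal (by positivity) (eLpNorm_vel_le v)
  calc normFour v ^ 2 ≤ (2 * √(5 * ‖vel v‖ * ‖v‖)) ^ 2 :=
        pow_le_pow_left₀ (normFour_nonneg v) h 2
    _ = _ := by rw [mul_pow, Real.sq_sqrt (by positivity)]; ring

lemma normFour_le (v : V) : normFour v ≤ 5 * ‖v‖ := by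
  refine le_of_sq_le_sq ?_ (by positivity)
  nlinarith [normFour_sq_le v, mul_le_mul_of_nonneg_right (norm_vel_le v) (norm_nonneg v),
    sq_nonneg ‖v‖]

lemma abs_convection_integrand_le (a b : Vec) (G : Mat) :
    |∑ i : Fin 2, ∑ j : Fin 2, a j * G (i, j) * b i| ≤ ‖a‖ * ‖b‖ * ‖G‖ := by
  refine abs_le_of_sq_le_sq ?_ (by positivity)
  have h := Finset.sum_mul_sq_le_sq_mul_sq (Finset.univ : Finset (Fin 2 × Fin 2))
    (fun p => a p.2 * b p.1) (fun p => G p)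
  rw [mul_pow, mul_pow, EuclideanSpace.real_norm_sq_eq, EuclideanSpace.real_norm_sq_eq,
    EuclideanSpace.real_norm_sq_eq]
  simp only [Fintype.sum_prod_type, Fin.sum_univ_two] at h ⊢
  nlinarith [h]

lemma integrable_convection_term (z u v : V) (i j : Fin 2) :
    Integrable (fun x => vel z x j * grad u x (i, j) * vel v x i) torusMeasure := by
  have hm : ∀ {ι : Type} [Fintype ι] (w : Lp (EuclideanSpace ℝ ι) 2 torusMeasure) (p : ι),
      AEStronglyMeasurable (fun x => w x p) torusMeasure := fun w p =>
    (EuclideanSpace.proj (𝕜 := ℝ) p).continuous.comp_aestronglyMeasurable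
      (Lp.aestronglyMeasurable w)
  refine (integrable_norm_mul_norm_mul_norm (memLp_vel_four z) (memLp_vel_four v)
    (Lp.memLp (grad u))).1.mono' (((hm _ _).mul (hm _ _)).mul (hm _ _)) (.of_forall fun x => ?_)
  rw [norm_mul, norm_mul, mul_right_comm]
  gcongr <;> exact PiLp.norm_apply_le _ _

lemma integrable_convection (z u v : V) : Integrable (fun x => ∑ i : Fin 2, ∑ j : Fin 2,
    vel z x j * grad u x (i, j) * vel v x i) torusMeasure :=
  integrable_finsetSum _ fun i _ => integrable_finsetSum _ fun j _ =>
    integrable_convection_term z u v i j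

lemma abs_convection_le (z u v : V) :
    |convection z u v| ≤ normFour z * normFour v * ‖grad u‖ := by
  have h := integrable_norm_mul_norm_mul_norm (memLp_vel_four z) (memLp_vel_four v)
    (Lp.memLp (grad u))
  rw [eLpNorm_two_toReal] at h
  exact (norm_integral_le_of_norm_le (f := fun x => ∑ i : Fin 2, ∑ j : Fin 2,
    vel z x j * grad u x (i, j) * vel v x i) h.1
    (.of_forall fun x => abs_convection_integrand_le _ _ _)).trans h.2

/-- The convection form is antisymmetric in its last two arguments, because the first one is
divergence free. -/
lemma convection_antisymm (z u v : V) : convection z u v = -convection z v u := by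
  rw [eq_neg_iff_add_eq_zero, convection, convection,
    ← integral_add (integrable_convection z u v) (integrable_convection z v u)]
  have hz : ∀ j, MemLp (component j (vel z)) 4 torusMeasure := fun j =>
    (hasWeakGrad_component z j).memLp_four
  have hreal : ∀ j, ∀ᵐ x ∂torusMeasure,
      (starRingEnd ℂ) (component j (vel z) x) = component j (vel z) x := by
    intro j
    filter_upwards [coeFn_component j (vel z)] with x hx
    rw [hx, Complex.conj_ofReal]
  have hi : ∀ i : Fin 2, ∫ x, ∑ j, vel z x j * (grad u x (i, j) * vel v x i +
      vel u x i * grad v x (i, j)) ∂torusMeasure = 0 := by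
    intro i
    have h := integral_transport_eq_zero hz hreal (sum_coeff_vel_eq_zero z)
      (hasWeakGrad_component u i) (hasWeakGrad_component v i)
    have h2 : ((∫ x, ∑ j, vel z x j * (grad u x (i, j) * vel v x i +
      vel u x i * grad v x (i, j)) ∂torusMeasure : ℝ) : ℂ) = 0 := by
      rw [← h, ← integral_complex_ofReal]
      refine integral_congr_ae ?_
      filter_upwards [coeFn_component_all (vel z), coeFn_component_all (vel u),
        coeFn_component_all (vel v), coeFn_component_all (grad u),
        coeFn_component_all (grad v)] with x h1 h2 h3 h4 h5
      simp only [h1, h2, h3, h4, h5]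
      push_cast
      rfl
    exact_mod_cast h2
  have hint : ∀ i : Fin 2, Integrable (fun x => ∑ j, vel z x j * (grad u x (i, j) * vel v x i +
      vel u x i * grad v x (i, j))) torusMeasure := by
    intro i
    refine integrable_finsetSum _ fun j _ => ?_
    refine ((integrable_convection_term z u v i j).add
      (integrable_convection_term z v u i j)).congr (.of_forall fun x => ?_)
    simp only [Pi.add_apply]
    ring
  rw [← Finset.sum_eq_zero fun i (_ : i ∈ Finset.univ) => hi i,
    ← integral_finsetSum _ fun i _ => hint i]
  refine integral_congr_ae (.of_forall fun x => ?_)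
  simp only [← Finset.sum_add_distrib]
  exact Finset.sum_congr rfl fun i _ => Finset.sum_congr rfl fun j _ => by ring

lemma ae_vel_add (v w : V) : ∀ᵐ x ∂torusMeasure, vel (v + w) x = vel v x + vel w x :=
  Lp.coeFn_add (vel v) (vel w)

lemma ae_vel_smul (c : ℝ) (v : V) : ∀ᵐ x ∂torusMeasure, vel (c • v) x = c • vel v x :=
  Lp.coeFn_smul c (vel v)

lemma convection_add_left (z z' u v : V) :
    convection (z + z') u v = convection z u v + convection z' u v := by
  rw [convection, convection, convection,
    ← integral_add (integrable_convection z u v) (integrable_convection z' u v)]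
  refine integral_congr_ae ?_
  filter_upwards [ae_vel_add z z'] with x hx
  simp only [hx, PiLp.add_apply, ← Finset.sum_add_distrib]
  exact Finset.sum_congr rfl fun i _ => Finset.sum_congr rfl fun j _ => by ring

lemma convection_smul_left (c : ℝ) (z u v : V) :
    convection (c • z) u v = c * convection z u v := by
  rw [convection, convection, ← integral_const_mul]
  refine integral_congr_ae ?_
  filter_upwards [ae_vel_smul c z] with x hx
  simp only [hx, PiLp.smul_apply, smul_eq_mul, Finset.mul_sum]
  exact Finset.sum_congr rfl fun i _ => Finset.sum_congr rfl fun j _ => by ring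

lemma convection_add_right (z u v v' : V) :
    convection z u (v + v') = convection z u v + convection z u v' := by
  rw [convection, convection, convection,
    ← integral_add (integrable_convection z u v) (integrable_convection z u v')]
  refine integral_congr_ae ?_
  filter_upwards [ae_vel_add v v'] with x hx
  simp only [hx, PiLp.add_apply, ← Finset.sum_add_distrib]
  exact Finset.sum_congr rfl fun i _ => Finset.sum_congr rfl fun j _ => by ring

lemma convection_smul_right (c : ℝ) (z u v : V) :
    convection z u (c • v) = c * convection z u v := by
  rw [convection, convection, ← integral_const_mul]
  refine integral_congr_ae ?_
  filter_upwards [ae_vel_smul c v] with x hx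
  simp only [hx, PiLp.smul_apply, smul_eq_mul, Finset.mul_sum]
  exact Finset.sum_congr rfl fun i _ => Finset.sum_congr rfl fun j _ => by ring

lemma convection_self_eq_zero (z u : V) : convection z u u = 0 := by
  linarith [convection_antisymm z u u]

/-- By antisymmetry the derivative falls on the test function, and no gradient of `z` or `u` is
needed. -/
lemma abs_convection_le_mul_norm (z u v : V) :
    |convection z u v| ≤ normFour z * normFour u * ‖v‖ := by
  rw [convection_antisymm, abs_neg]
  refine (abs_convection_le z v u).trans ?_
  have := normFour_nonneg z
  have := normFour_nonneg u
  gcongr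
  exact norm_grad_le v

/-- The functional `v ↦ c(z, u, v)`. -/
noncomputable def convectionDual (z u : V) : VDual :=
  LinearMap.mkContinuous ⟨⟨convection z u, convection_add_right z u⟩,
    fun c v => convection_smul_right c z u v⟩ (normFour z * normFour u)
    (abs_convection_le_mul_norm z u)

@[simp]
lemma convectionDual_apply (z u v : V) : convectionDual z u v = convection z u v := rfl

lemma norm_convectionDual_le (z u : V) : ‖convectionDual z u‖ ≤ normFour z * normFour u :=
  LinearMap.mkContinuous_norm_le _ (mul_nonneg (normFour_nonneg z) (normFour_nonneg u)) _

/-- The bounded bilinear map `(z, u) ↦ c(z, u, ·)` into `V'`. -/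
noncomputable def convectionL : V →L[ℝ] V →L[ℝ] VDual :=
  LinearMap.mkContinuous₂
    (LinearMap.mk₂ ℝ convectionDual
      (fun z z' u => ContinuousLinearMap.ext fun v => by
        simpa using convection_add_left z z' u v)
      (fun c z u => ContinuousLinearMap.ext fun v => by
        simpa using convection_smul_left c z u v)
      (fun z u u' => ContinuousLinearMap.ext fun v => by
        simp only [convectionDual_apply, add_apply]
        rw [convection_antisymm z (u + u'), convection_antisymm z u, convection_antisymm z u',
          convection_add_right]
        ring)
      (fun c z u => ContinuousLinearMap.ext fun v => by
        change convection z (c • u) v = c * convection z u v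
        rw [convection_antisymm z (c • u), convection_antisymm z u, convection_smul_right]
        ring)) 25 fun z u => by
    refine (norm_convectionDual_le z u).trans ?_
    have h := mul_le_mul (normFour_le z) (normFour_le u) (normFour_nonneg u) (by positivity)
    linarith

@[simp]
lemma convectionL_apply (z u v : V) : convectionL z u v = convection z u v := rfl

lemma norm_convectionL_le (z u : V) : ‖convectionL z u‖ ≤ normFour z * normFour u :=
  norm_convectionDual_le z u

/-- The viscous term `u ↦ ν (∇u, ∇·)` as a bounded operator into `V'`. -/
noncomputable def viscousL (ν : ℝ) : V →L[ℝ] VDual :=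
  LinearMap.mkContinuous₂
    (LinearMap.mk₂ ℝ (fun u v : V => ν * inner ℝ (gradL u) (gradL v))
      (fun u u' v => by rw [map_add, inner_add_left, mul_add])
      (fun c u v => by rw [map_smul, real_inner_smul_left, smul_eq_mul, mul_left_comm])
      (fun u v v' => by rw [map_add, inner_add_right, mul_add])
      (fun c u v => by rw [map_smul, real_inner_smul_right, smul_eq_mul, mul_left_comm])) |ν|
    fun u v => by
    rw [LinearMap.mk₂_apply, norm_mul, Real.norm_eq_abs, mul_assoc]
    gcongr
    refine (abs_real_inner_le_norm (grad u) (grad v)).trans ?_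
    exact mul_le_mul (norm_grad_le u) (norm_grad_le v) (norm_nonneg _) (norm_nonneg _)

@[simp]
lemma viscousL_apply (ν : ℝ) (u v : V) : viscousL ν u v = ν * inner ℝ (grad u) (grad v) := rfl

lemma norm_viscousL_le (ν : ℝ) (u : V) : ‖viscousL ν u‖ ≤ |ν| * ‖u‖ := by
  refine ContinuousLinearMap.opNorm_le_bound _ (by positivity) fun v => ?_
  rw [viscousL_apply, norm_mul, Real.norm_eq_abs, mul_assoc]
  gcongr
  refine (abs_real_inner_le_norm (grad u) (grad v)).trans ?_
  exact mul_le_mul (norm_grad_le u) (norm_grad_le v) (norm_nonneg _) (norm_nonneg _)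

-- Unfolding these operators makes unification in the dual of `V` very slow.
attribute [irreducible] convectionL viscousL

/-! ### Trajectories and residuals -/

lemma memLp_toDual_symm {μ : Measure ℝ} {y : ℝ → VDual} (hy : MemLp y 2 μ) :
    MemLp (fun t => (InnerProductSpace.toDual ℝ V).symm (y t)) 2 μ :=
  MemLp.of_le (F := VDual) hy
    ((InnerProductSpace.toDual ℝ V).symm.continuous.comp_aestronglyMeasurable hy.1)
    (.of_forall fun t => by rw [LinearIsometryEquiv.norm_map])

lemma aestronglyMeasurable_bilin {E G : Type*} [NormedAddCommGroup E] [NormedSpace ℝ E]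
    [NormedAddCommGroup G] [NormedSpace ℝ G] (B : E →L[ℝ] E →L[ℝ] G) {μ : Measure ℝ} {y : ℝ → E}
    (hy : AEStronglyMeasurable y μ) : AEStronglyMeasurable (fun t => B (y t) (y t)) μ :=
  (B.continuous.clm_apply continuous_id).comp_aestronglyMeasurable hy

lemma memLp_clm {E G : Type*} [NormedAddCommGroup E] [NormedSpace ℝ E]
    [NormedAddCommGroup G] [NormedSpace ℝ G] (B : E →L[ℝ] G) {μ : Measure ℝ} {y : ℝ → E}
    (hy : MemLp y 2 μ) : MemLp (fun t => B (y t)) 2 μ :=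
  B.comp_memLp' hy

section Trajectories

variable {a b : ℝ} {u w : ℝ → V} {u' w' : ℝ → VDual}

lemma IsTrajectory.sub (hu : IsTrajectory a b u u') (hw : IsTrajectory a b w w') :
    IsTrajectory a b (u - w) (u' - w') := by
  refine ⟨hu.memLp.sub hw.memLp, MemLp.sub (E := VDual) hu.memLp_deriv hw.memLp_deriv, fun φ hφ hφc hφs v => ?_⟩
  have h1 := hu.weakDeriv φ hφ hφc hφs v
  have h2 := hw.weakDeriv φ hφ hφc hφs v
  have hφ' : Continuous (deriv φ) := hφ.continuous_deriv (by simp)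
  have hi1 : ∀ {y : ℝ → V}, MemLp y 2 (volume.restrict (Icc a b)) →
      IntegrableOn (fun t => deriv φ t * inner ℝ (vel (y t)) (vel v)) (Icc a b) := by
    intro y hy
    have h : IntegrableOn (fun t => inner ℝ (velL (y t)) (velL v)) (Icc a b) :=
      (velL.integrable_comp (hy.integrable (by norm_num))).inner_const _
    exact h.continuousOn_mul hφ'.continuousOn isCompact_Icc
  have hi2 : ∀ {y : ℝ → VDual}, MemLp y 2 (volume.restrict (Icc a b)) →
      IntegrableOn (fun t => φ t * y t v) (Icc a b) := by
    intro y hy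
    have h : IntegrableOn (fun t => y t v) (Icc a b) := by
      have := ((memLp_toDual_symm hy).integrable (by norm_num)).inner_const (𝕜 := ℝ) v
      refine this.congr (.of_forall fun t => ?_)
      exact InnerProductSpace.toDual_symm_apply (𝕜 := ℝ)
    exact h.continuousOn_mul hφ.continuous.continuousOn isCompact_Icc
  have e1 : ∀ t, deriv φ t * inner ℝ (vel ((u - w) t)) (vel v) =
      deriv φ t * inner ℝ (vel (u t)) (vel v) - deriv φ t * inner ℝ (vel (w t)) (vel v) := by
    intro t
    have : vel ((u - w) t) = vel (u t) - vel (w t) := rfl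
    rw [this, inner_sub_left, mul_sub]
  have e2 : ∀ t, φ t * (u' - w') t v = φ t * u' t v - φ t * w' t v := by
    intro t
    have : (u' - w') t v = u' t v - w' t v := rfl
    rw [this, mul_sub]
  simp only [e1, e2]
  rw [integral_sub (hi1 hu.memLp) (hi1 hw.memLp), integral_sub (hi2 hu.memLp_deriv)
    (hi2 hw.memLp_deriv), h1, h2]
  ring

/-- A trajectory has a continuous representative in `L²`, and this satisfies the energy identity. -/
lemma IsTrajectory.exists_continuous (hab : a < b) (h : IsTrajectory a b u u') :
    ∃ e : ℝ → L2Vec, ContinuousOn e (Icc a b) ∧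
      (∀ᵐ t ∂volume.restrict (Icc a b), e t = vel (u t)) ∧
      ∀ s ∈ Icc a b, ∀ t ∈ Icc a b,
        ‖e t‖ ^ 2 - ‖e s‖ ^ 2 = 2 * ∫ τ in s..t, u' τ (u τ) := by
  set r : ℝ → V := fun t => (InnerProductSpace.toDual ℝ V).symm (u' t) with hr
  have hrin : ∀ t v, inner ℝ (r t) v = u' t v := fun t v =>
    InnerProductSpace.toDual_symm_apply
  have hrL : MemLp r 2 (volume.restrict (Icc a b)) := memLp_toDual_symm h.memLp_deriv
  obtain ⟨e, he, hae, hen⟩ := exists_continuous_representative norm_velL_le vel_injective hab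
    h.memLp hrL (fun φ hφ hφc hφs v => by
      simpa only [hrin, velL_apply] using h.weakDeriv φ hφ hφc hφs v)
  refine ⟨e, he, hae, fun s hs t ht => ?_⟩
  rw [hen s hs t ht]
  simp only [real_inner_comm (r _), hrin]

lemma IsTrajectory.exists_norm_vel_le (hab : a < b) (h : IsTrajectory a b u u') :
    ∃ K, 0 ≤ K ∧ ∀ᵐ t ∂volume.restrict (Icc a b), ‖vel (u t)‖ ≤ K := by
  obtain ⟨e, he, hae, -⟩ := h.exists_continuous hab
  obtain ⟨K, hK⟩ := isCompact_Icc.exists_bound_of_continuousOn he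
  refine ⟨K, (norm_nonneg _).trans (hK a (left_mem_Icc.2 hab.le)), ?_⟩
  filter_upwards [hae, ae_restrict_mem measurableSet_Icc] with t ht htab
  rw [← ht]
  exact hK t htab

lemma IsTrajectory.integrable_norm_sq (h : IsTrajectory a b u u') :
    IntegrableOn (fun t => ‖u t‖ ^ 2) (Icc a b) :=
  h.memLp.integrable_norm_pow (by simp)

lemma IsTrajectory.integrable_deriv_norm_sq (h : IsTrajectory a b u u') :
    IntegrableOn (fun t => ‖u' t‖ ^ 2) (Icc a b) :=
  MemLp.integrable_norm_pow (β := VDual) (p := 2) h.memLp_deriv (by simp)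

lemma IsTrajectory.integrable_pairing (h : IsTrajectory a b u u') :
    IntegrableOn (fun t => u' t (u t)) (Icc a b) := by
  refine (h.integrable_norm_sq.add h.integrable_deriv_norm_sq).mono'
    (isBoundedBilinearMap_apply.continuous.comp_aestronglyMeasurable
      (h.memLp_deriv.1.prodMk h.memLp.1)) (.of_forall fun t => ?_)
  refine ((u' t).le_opNorm _).trans ?_
  simp only [Pi.add_apply]
  nlinarith [sq_nonneg (‖u' t‖ - ‖u t‖), sq_nonneg (‖u' t‖ + ‖u t‖)]

/-- The embedding of trajectories into `L^∞(a, b; L²)` with an explicit constant, obtained by averaging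
the energy identity over the initial time. -/
lemma IsTrajectory.norm_vel_sq_le (hab : a < b) (h : IsTrajectory a b u u') :
    ∀ᵐ t ∂volume.restrict (Icc a b), ‖vel (u t)‖ ^ 2 ≤ ((b - a)⁻¹ + 1) *
      ((∫ t in Icc a b, ‖u t‖ ^ 2) + ∫ t in Icc a b, ‖u' t‖ ^ 2) := by
  obtain ⟨e, he, hae, hen⟩ := h.exists_continuous hab
  set A := ∫ t in Icc a b, ‖u t‖ ^ 2 with hA
  set B := ∫ t in Icc a b, ‖u' t‖ ^ 2 with hB
  have hA0 : 0 ≤ A := integral_nonneg fun t => by positivity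
  have hB0 : 0 ≤ B := integral_nonneg fun t => by positivity
  have hsum := h.integrable_norm_sq.add h.integrable_deriv_norm_sq
  have hdiff : ∀ s ∈ Icc a b, ∀ t ∈ Icc a b, ‖e t‖ ^ 2 - (A + B) ≤ ‖e s‖ ^ 2 := by
    intro s hs t ht
    have hsub : uIoc s t ⊆ Icc a b := by
      rw [← uIcc_of_le hab.le]
      exact uIoc_subset_uIcc.trans (uIcc_subset_uIcc (by rwa [uIcc_of_le hab.le])
        (by rwa [uIcc_of_le hab.le]))
    have hle : ‖∫ τ in s..t, 2 * u' τ (u τ)‖ ≤ A + B := by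
      rw [intervalIntegral.norm_integral_eq_norm_integral_uIoc, hA, hB,
        ← integral_add h.integrable_norm_sq h.integrable_deriv_norm_sq]
      refine (norm_integral_le_of_norm_le (hsum.mono_set hsub) (.of_forall fun τ => ?_)).trans
        (setIntegral_mono_set hsum (.of_forall fun τ => by
          simp only [Pi.zero_apply, Pi.add_apply]; positivity) hsub.eventuallyLE)
      rw [norm_mul, Real.norm_two]
      have := (u' τ).le_opNorm (u τ)
      simp only [Pi.add_apply]
      nlinarith [sq_nonneg (‖u' τ‖ - ‖u τ‖)]
    rw [intervalIntegral.integral_const_mul, ← hen s hs t ht] at hle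
    linarith [(abs_le.1 hle).2]
  have heA : ∫ s in Icc a b, ‖e s‖ ^ 2 ≤ A := by
    refine integral_mono_ae ((he.norm.pow 2).integrableOn_compact isCompact_Icc)
      h.integrable_norm_sq ?_
    filter_upwards [hae] with t ht
    simp only [ht]
    exact pow_le_pow_left₀ (norm_nonneg _) (norm_vel_le _) 2
  filter_upwards [hae, ae_restrict_mem measurableSet_Icc] with t ht htab
  rw [← ht]
  have hmono : ∫ _ in Icc a b, (‖e t‖ ^ 2 - (A + B)) ≤ ∫ s in Icc a b, ‖e s‖ ^ 2 :=
    setIntegral_mono_on (by simp) ((he.norm.pow 2).integrableOn_compact isCompact_Icc)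
      measurableSet_Icc fun s hs => hdiff s hs t htab
  rw [setIntegral_const, measureReal_def, Real.volume_Icc,
    ENNReal.toReal_ofReal (by linarith), smul_eq_mul] at hmono
  have hba : 0 < b - a := by linarith
  have h1 : ‖e t‖ ^ 2 - (A + B) ≤ (b - a)⁻¹ * A := by
    rw [inv_mul_eq_div, le_div_iff₀ hba]
    linarith
  have h2 : (b - a)⁻¹ * A ≤ (b - a)⁻¹ * (A + B) := by gcongr; linarith
  linarith

end Trajectories

section Residual

variable {ν a b : ℝ} {f : ℝ → VDual} {u w : ℝ → V} {u' w' R : ℝ → VDual}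

lemma exists_memLp_residual (ν : ℝ) (hab : a < b) (hf : MemLp f 2 (volume.restrict (Icc a b)))
    (hw : IsTrajectory a b w w') :
    ∃ R : ℝ → VDual, MemLp R 2 (volume.restrict (Icc a b)) ∧ IsResidual ν a b f w w' R := by
  obtain ⟨K, hK0, hK⟩ := hw.exists_norm_vel_le hab
  have hconv : MemLp (fun t => convectionL (w t) (w t)) 2 (volume.restrict (Icc a b)) := by
    refine MemLp.of_le_mul (E := VDual) (c := 20 * K) hw.memLp ?_ ?_
    · exact aestronglyMeasurable_bilin (G := VDual) convectionL hw.memLp.1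
    · filter_upwards [hK] with t ht
      refine (norm_convectionL_le _ _).trans ?_
      rw [← sq]
      refine (normFour_sq_le (w t)).trans ?_
      rw [mul_assoc]
      gcongr
  have hvisc : MemLp (fun t => viscousL ν (w t)) 2 (volume.restrict (Icc a b)) :=
    memLp_clm (G := VDual) (viscousL ν) hw.memLp
  refine ⟨fun t => f t - w' t - convectionL (w t) (w t) - viscousL ν (w t),
    MemLp.sub (E := VDual) (MemLp.sub (E := VDual) (MemLp.sub (E := VDual) hf hw.memLp_deriv) hconv)
      hvisc, .of_forall fun t v => ?_⟩
  rw [sub_apply, sub_apply, sub_apply, convectionL_apply, viscousL_apply]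

lemma IsResidual.memLp (hab : a < b) (hf : MemLp f 2 (volume.restrict (Icc a b)))
    (hw : IsTrajectory a b w w') (hR : IsResidual ν a b f w w' R) :
    MemLp R 2 (volume.restrict (Icc a b)) := by
  obtain ⟨R₀, hR₀, h⟩ := exists_memLp_residual ν hab hf hw
  refine hR₀.ae_eq ?_
  filter_upwards [h, hR] with t h1 h2
  ext v
  rw [h1, h2]

/-- The residual in terms of the error `u - w`. -/
lemma IsResidual.ae_eq (hu : IsWeakSolution ν a b f u u') (hR : IsResidual ν a b f w w' R) :
    ∀ᵐ t ∂volume.restrict (Icc a b), R t = (u' t - w' t) + convectionL (u t - w t) (u t) +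
      convectionL (w t) (u t - w t) + viscousL ν (u t - w t) := by
  filter_upwards [hu.equation, hR] with t h1 h2
  ext v
  have h3 := h1 v
  rw [h2 v, ← h3]
  simp only [map_sub, add_apply, sub_apply, convectionL_apply, viscousL_apply]
  ring

/-- The error equation tested with the error. -/
lemma IsResidual.pairing_error_eq (hu : IsWeakSolution ν a b f u u')
    (hR : IsResidual ν a b f w w' R) :
    ∀ᵐ t ∂volume.restrict (Icc a b), (u' t - w' t) (u t - w t) = R t (u t - w t) -
      convection (u t - w t) (w t) (u t - w t) - ν * ‖grad (u t - w t)‖ ^ 2 := by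
  filter_upwards [hR.ae_eq hu] with t h
  set e := u t - w t with he
  have hut : u t = e + w t := by rw [he]; abel
  have h1 := congrArg (fun F : VDual => F e) h
  simp only [add_apply, convectionL_apply, viscousL_apply,
    convection_self_eq_zero (w t) e, real_inner_self_eq_norm_sq] at h1
  have h2 : convection e (u t) e = convection e (w t) e := by
    rw [← convectionL_apply, hut, map_add, add_apply, convectionL_apply, convectionL_apply,
      convection_self_eq_zero, zero_add]
  rw [h1, h2]
  ring

end Residual

/-! ### Efficiency and reliability of the residual -/

variable {ν a b : ℝ} {f : ℝ → VDual} {u w : ℝ → V} {u' w' R : ℝ → VDual}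

/-- Bound for the residual at a fixed time. To keep the growth in `N` quadratic, the factor
`‖w‖_V` is split as `‖u‖_V + ‖u - w‖_V`; the `L²` norm of the error is estimated by `δ` in the
first part and by `M + N` in the second. -/
lemma norm_residual_sq_le {ν M N δ : ℝ} {u w : V} {e' R : VDual} (hM : ‖vel u‖ ≤ M)
    (hN : ‖vel w‖ ≤ N) (hδ : ‖vel (u - w)‖ ≤ δ)
    (hR : R = e' + convectionL (u - w) u + convectionL w (u - w) + viscousL ν (u - w)) :
    ‖R‖ ^ 2 ≤ 4 * (‖e'‖ ^ 2 + (200 * M + 200 * N + 400 * (N * (M + N)) + ν ^ 2) * ‖u - w‖ ^ 2 +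
      (200 * M + 200 * N) * δ ^ 2 * ‖u‖ ^ 2) := by
  set e := u - w with he
  have hM0 : 0 ≤ M := (norm_nonneg _).trans hM
  have hN0 : 0 ≤ N := (norm_nonneg _).trans hN
  have hδ0 : 0 ≤ δ := (norm_nonneg _).trans hδ
  have h1 : ‖R‖ ≤ ‖e'‖ + normFour e * normFour u + normFour w * normFour e + |ν| * ‖e‖ := by
    rw [hR]
    have hadd : ∀ F G : VDual, ‖F + G‖ ≤ ‖F‖ + ‖G‖ := fun F G => norm_add_le F G
    linarith [hadd (e' + convectionL e u + convectionL w e) (viscousL ν e),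
      hadd (e' + convectionL e u) (convectionL w e), hadd e' (convectionL e u),
      norm_convectionL_le e u, norm_convectionL_le w e, norm_viscousL_le ν e]
  have h2 : ‖R‖ ^ 2 ≤ 4 * (‖e'‖ ^ 2 + normFour e ^ 2 * normFour u ^ 2 +
      normFour w ^ 2 * normFour e ^ 2 + ν ^ 2 * ‖e‖ ^ 2) := by
    have h3 := pow_le_pow_left₀ (norm_nonneg R) h1 2
    refine h3.trans ?_
    rw [← sq_abs ν, ← mul_pow, ← mul_pow, ← mul_pow]
    generalize ‖e'‖ = p
    generalize normFour e * normFour u = q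
    generalize normFour w * normFour e = r
    generalize |ν| * ‖e‖ = s
    nlinarith [sq_nonneg (p - q), sq_nonneg (p - r), sq_nonneg (p - s), sq_nonneg (q - r),
      sq_nonneg (q - s), sq_nonneg (r - s)]
  have hw : ‖w‖ ≤ ‖u‖ + ‖e‖ := by
    have : w = u - e := by rw [he]; abel
    rw [this]
    exact norm_sub_le _ _
  have heN : ‖vel e‖ ≤ M + N := by
    have : vel e = vel u - vel w := rfl
    rw [this]
    exact (norm_sub_le _ _).trans (add_le_add hM hN)
  have hyoung : ‖vel e‖ * ‖e‖ * ‖u‖ ≤ (‖e‖ ^ 2 + δ ^ 2 * ‖u‖ ^ 2) / 2 := by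
    calc ‖vel e‖ * ‖e‖ * ‖u‖ ≤ δ * ‖e‖ * ‖u‖ := by gcongr
      _ ≤ _ := by nlinarith [sq_nonneg (‖e‖ - δ * ‖u‖)]
  have h4 : normFour e ^ 2 * normFour u ^ 2 ≤ 200 * M * (‖e‖ ^ 2 + δ ^ 2 * ‖u‖ ^ 2) := by
    calc normFour e ^ 2 * normFour u ^ 2 ≤ (20 * (‖vel e‖ * ‖e‖)) * (20 * (‖vel u‖ * ‖u‖)) := by
          gcongr <;> exact normFour_sq_le _
      _ ≤ (20 * (‖vel e‖ * ‖e‖)) * (20 * (M * ‖u‖)) := by gcongr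
      _ = 400 * M * (‖vel e‖ * ‖e‖ * ‖u‖) := by ring
      _ ≤ 400 * M * ((‖e‖ ^ 2 + δ ^ 2 * ‖u‖ ^ 2) / 2) := by gcongr
      _ = _ := by ring
  have h5 : normFour w ^ 2 * normFour e ^ 2 ≤ 200 * N * (‖e‖ ^ 2 + δ ^ 2 * ‖u‖ ^ 2) +
      400 * (N * (M + N)) * ‖e‖ ^ 2 := by
    calc normFour w ^ 2 * normFour e ^ 2 ≤ (20 * (‖vel w‖ * ‖w‖)) * (20 * (‖vel e‖ * ‖e‖)) := by
          gcongr <;> exact normFour_sq_le _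
      _ ≤ (20 * (N * (‖u‖ + ‖e‖))) * (20 * (‖vel e‖ * ‖e‖)) := by gcongr
      _ = 400 * N * (‖vel e‖ * ‖e‖ * ‖u‖) + 400 * (N * ‖vel e‖) * ‖e‖ ^ 2 := by ring
      _ ≤ 400 * N * ((‖e‖ ^ 2 + δ ^ 2 * ‖u‖ ^ 2) / 2) + 400 * (N * (M + N)) * ‖e‖ ^ 2 := by
          gcongr
      _ = _ := by ring
  linarith

/-- Efficiency of the residual with an explicit constant. -/
theorem integral_residual_sq_le (hab : a < b) {M N : ℝ} (hu : IsWeakSolution ν a b f u u')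
    (hM : ∀ᵐ t ∂volume.restrict (Icc a b), ‖vel (u t)‖ ≤ M)
    (hM2 : ∫ t in Icc a b, ‖u t‖ ^ 2 ≤ M ^ 2) (hw : IsTrajectory a b w w')
    (hN : ∀ᵐ t ∂volume.restrict (Icc a b), ‖vel (w t)‖ ≤ N) (hR : IsResidual ν a b f w w' R) :
    ∫ t in Icc a b, ‖R t‖ ^ 2 ≤
      (4 * (1 + 600 * M + 600 + ν ^ 2 + (200 * M + 200) * ((b - a)⁻¹ + 1) * M ^ 2)) *
        (1 + N ^ 2) *
        ((∫ t in Icc a b, ‖u t - w t‖ ^ 2) + ∫ t in Icc a b, ‖u' t - w' t‖ ^ 2) := by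
  have he := hu.trajectory.sub hw
  set A := ∫ t in Icc a b, ‖u t - w t‖ ^ 2 with hA
  set B := ∫ t in Icc a b, ‖u' t - w' t‖ ^ 2 with hB
  set k := (b - a)⁻¹ + 1 with hk
  have hA0 : 0 ≤ A := integral_nonneg fun t => by positivity
  have hB0 : 0 ≤ B := integral_nonneg fun t => by positivity
  have hba : 0 < b - a := sub_pos.2 hab
  have hk0 : 0 ≤ k := by positivity
  obtain ⟨hM0, hN0⟩ : 0 ≤ M ∧ 0 ≤ N := by
    have : NeBot (ae (volume.restrict (Icc a b))) := by
      rw [ae_neBot]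
      simp [Measure.restrict_eq_zero, hab]
    obtain ⟨t, h1, h2⟩ := (hM.and hN).exists
    exact ⟨(norm_nonneg _).trans h1, (norm_nonneg _).trans h2⟩
  have hδ : ∀ᵐ t ∂volume.restrict (Icc a b), ‖vel (u t - w t)‖ ≤ √(k * (A + B)) := by
    filter_upwards [he.norm_vel_sq_le hab] with t ht
    exact Real.le_sqrt_of_sq_le ht
  have hpt : ∀ᵐ t ∂volume.restrict (Icc a b), ‖R t‖ ^ 2 ≤ 4 * (‖u' t - w' t‖ ^ 2 +
      (200 * M + 200 * N + 400 * (N * (M + N)) + ν ^ 2) * ‖u t - w t‖ ^ 2 +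
      (200 * M + 200 * N) * (k * (A + B)) * ‖u t‖ ^ 2) := by
    filter_upwards [hM, hN, hδ, hR.ae_eq hu] with t h1 h2 h3 h4
    have := norm_residual_sq_le h1 h2 h3 h4
    rwa [Real.sq_sqrt (by positivity)] at this
  have hie : IntegrableOn (fun t => ‖u t - w t‖ ^ 2) (Icc a b) := he.integrable_norm_sq
  have hie' : IntegrableOn (fun t => ‖u' t - w' t‖ ^ 2) (Icc a b) := he.integrable_deriv_norm_sq
  have hiu := hu.trajectory.integrable_norm_sq
  have hint : ∫ t in Icc a b, ‖R t‖ ^ 2 ≤ 4 * (B +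
      (200 * M + 200 * N + 400 * (N * (M + N)) + ν ^ 2) * A +
      (200 * M + 200 * N) * (k * (A + B)) * ∫ t in Icc a b, ‖u t‖ ^ 2) := by
    refine (integral_mono_of_nonneg (.of_forall fun t => by simp only [Pi.zero_apply]; positivity)
      (((hie'.add (hie.const_mul _)).add (hiu.const_mul _)).const_mul 4) hpt).trans (le_of_eq ?_)
    rw [integral_const_mul, integral_add' (hie'.add (hie.const_mul _)) (hiu.const_mul _),
      integral_add' hie' (hie.const_mul _), integral_const_mul, integral_const_mul]
  have hN1 : N ≤ 1 + N ^ 2 := by nlinarith [sq_nonneg (N - 1)]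
  have hP : 1 ≤ 1 + N ^ 2 := by nlinarith
  have hN2 : N ^ 2 ≤ 1 + N ^ 2 := by linarith
  set P := 1 + N ^ 2 with hPdef
  have hP0 : 0 ≤ P := by linarith
  have e1 : 200 * M + 200 * N ≤ (200 * M + 200) * P := by nlinarith
  have e2 : N * (M + N) ≤ (M + 1) * P := by nlinarith
  have e3 : ν ^ 2 ≤ ν ^ 2 * P := le_mul_of_one_le_right (sq_nonneg ν) hP
  refine hint.trans ?_
  calc 4 * (B + (200 * M + 200 * N + 400 * (N * (M + N)) + ν ^ 2) * A +
      (200 * M + 200 * N) * (k * (A + B)) * ∫ t in Icc a b, ‖u t‖ ^ 2)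
      ≤ 4 * (P * (A + B) + ((200 * M + 200) * P + 400 * ((M + 1) * P) + ν ^ 2 * P) * (A + B) +
        ((200 * M + 200) * P) * (k * (A + B)) * M ^ 2) := by
        gcongr
        · calc B ≤ 1 * (A + B) := by linarith
            _ ≤ P * (A + B) := by gcongr
        · linarith
    _ = _ := by ring

/-- Differential inequality for the error under the closeness assumption. By Poincaré's inequality
`ν/2 ‖∇e‖ ‖e‖_V` exceeds `ν/2 ‖∇e‖²` only slightly, and the viscous term still dominates. -/
lemma pairing_error_le_of_close {ν : ℝ} (hν : 0 < ν) {e w : V} {e' R : VDual}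
    (hmean : ∫ x, vel e x ∂torusMeasure = 0)
    (heq : e' e = R e - convection e w e - ν * ‖grad e‖ ^ 2)
    (hclose : |convection e w e| ≤ ν / 2 * ‖grad e‖ * ‖e‖) :
    2 * e' e + ν / 4 * ‖e‖ ^ 2 ≤ 4 / ν * ‖R‖ ^ 2 := by
  have hp := norm_vel_sq_le hmean
  have hn := norm_sq_eq e
  have hRe : R e ≤ ‖R‖ * ‖e‖ := (le_abs_self _).trans (R.le_opNorm e)
  have hy : 2 * (‖R‖ * ‖e‖) ≤ ν / 4 * ‖e‖ ^ 2 + 4 / ν * ‖R‖ ^ 2 := by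
    have h := sq_nonneg (ν / 4 * ‖e‖ - ‖R‖)
    have h2 : ν / 4 * ‖e‖ ^ 2 + 4 / ν * ‖R‖ ^ 2 - 2 * (‖R‖ * ‖e‖) =
        4 / ν * (ν / 4 * ‖e‖ - ‖R‖) ^ 2 := by
      field_simp
      ring
    have h3 : 0 ≤ 4 / ν * (ν / 4 * ‖e‖ - ‖R‖) ^ 2 := by positivity
    linarith
  have hc := (abs_le.1 hclose).1
  have hg : ‖grad e‖ * ‖e‖ ≤ (‖grad e‖ ^ 2 + ‖e‖ ^ 2) / 2 := by
    nlinarith [sq_nonneg (‖grad e‖ - ‖e‖)]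
  have hc2 : -(2 * convection e w e) ≤ ν * ((‖grad e‖ ^ 2 + ‖e‖ ^ 2) / 2) := by
    have := mul_le_mul_of_nonneg_left hg hν.le
    linarith
  have hfin : ν * (36 * ‖e‖ ^ 2) ≤ ν * (37 * ‖grad e‖ ^ 2) :=
    mul_le_mul_of_nonneg_left (by linarith) hν.le
  have hfin0 : 0 ≤ ν * ‖grad e‖ ^ 2 := by positivity
  rw [heq]
  linarith

/-- Differential inequality for the error under the Gårding inequality: the convective terms of the
linearised form at `e` are those of the error equation, so they cancel. -/
lemma pairing_error_le_of_garding {ν : ℝ} (hν : 0 < ν) {u w e : V} {e' R : VDual} {α β : ℝ}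
    (hue : u = w + e) (hβ : 0 < β) (hαβ : ν ≤ α - β)
    (hmean : ∫ x, vel e x ∂torusMeasure = 0)
    (heq : e' e = R e - convection e w e - ν * ‖grad e‖ ^ 2)
    (hgar : 2 * e' e + α * ‖grad e‖ ^ 2 ≤ linearizedForm ν u e e' e + β * ‖vel e‖ ^ 2) :
    2 * e' e + ν / 4 * ‖e‖ ^ 2 ≤ 4 / ν * ‖R‖ ^ 2 := by
  have hp := norm_vel_sq_le hmean
  have hn := norm_sq_eq e
  have hRe : R e ≤ ‖R‖ * ‖e‖ := (le_abs_self _).trans (R.le_opNorm e)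
  have hy : ‖R‖ * ‖e‖ ≤ ν / 16 * ‖e‖ ^ 2 + 4 / ν * ‖R‖ ^ 2 := by
    have h2 : ν / 16 * ‖e‖ ^ 2 + 4 / ν * ‖R‖ ^ 2 - ‖R‖ * ‖e‖ =
        4 / ν * (ν / 8 * ‖e‖ - ‖R‖) ^ 2 := by
      field_simp
      ring
    have h3 : 0 ≤ 4 / ν * (ν / 8 * ‖e‖ - ‖R‖) ^ 2 := by positivity
    linarith
  have hconv : convection e u e = convection e w e := by
    rw [← convectionL_apply, hue, map_add, add_apply, convectionL_apply, convectionL_apply,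
      convection_self_eq_zero e e, add_zero]
  rw [linearizedForm, convection_self_eq_zero, hconv, real_inner_self_eq_norm_sq] at hgar
  have h1 : β * ‖vel e‖ ^ 2 ≤ β * ‖grad e‖ ^ 2 :=
    mul_le_mul_of_nonneg_left (by nlinarith [sq_nonneg ‖vel e‖]) hβ.le
  have h2 : ν * ‖grad e‖ ^ 2 ≤ (α - β) * ‖grad e‖ ^ 2 :=
    mul_le_mul_of_nonneg_right hαβ (by positivity)
  have hfin : ν * (36 * ‖e‖ ^ 2) ≤ ν * (37 * ‖grad e‖ ^ 2) :=
    mul_le_mul_of_nonneg_left (by linarith) hν.le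
  have hfin0 : 0 ≤ ν * ‖grad e‖ ^ 2 := by positivity
  linarith

/-- The first reliability estimate, for all times at once. -/
theorem exists_error_bound (hν : 0 < ν) {s r : ℝ} (has : a ≤ s) (hsr : s < r) (hrb : r ≤ b)
    (hf : MemLp f 2 (volume.restrict (Icc a b))) (hu : IsWeakSolution ν a b f u u')
    (hw : IsTrajectory a b w w') (hR : IsResidual ν a b f w w' R)
    (hmean : ∀ᵐ t ∂volume.restrict (Icc s r), ∫ x, vel (u t - w t) x ∂torusMeasure = 0)
    (hstab : IsClose (ν / 2) s r u w ∨ SatisfiesGarding ν s r u (u - w) (u' - w')) :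
    ∃ e : ℝ → L2Vec, ContinuousOn e (Icc s r) ∧
      (∀ᵐ t ∂volume.restrict (Icc s r), e t = vel (u t - w t)) ∧
      ∀ t ∈ Icc s r, ‖e t‖ ^ 2 + ν / 4 * ∫ τ in Icc s t, ‖u τ - w τ‖ ^ 2 ≤
        ‖e s‖ ^ 2 + 4 / ν * ∫ τ in Icc s t, ‖R τ‖ ^ 2 := by
  have hab : a < b := by linarith
  have hsub : Icc s r ⊆ Icc a b := Icc_subset_Icc has hrb
  have hres : ∀ {p : ℝ → Prop}, (∀ᵐ t ∂volume.restrict (Icc a b), p t) →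
      ∀ᵐ t ∂volume.restrict (Icc s r), p t := fun h => ae_restrict_of_ae_restrict_of_subset hsub h
  have he := hu.trajectory.sub hw
  obtain ⟨e, hec, hae, hen⟩ := he.exists_continuous hab
  refine ⟨e, hec.mono hsub, hres hae, fun t ht => ?_⟩
  have hpt : ∀ᵐ τ ∂volume.restrict (Icc s r), 2 * (u' τ - w' τ) (u τ - w τ) +
      ν / 4 * ‖u τ - w τ‖ ^ 2 ≤ 4 / ν * ‖R τ‖ ^ 2 := by
    rcases hstab with hclose | ⟨α, β, -, hβ, hαβ, hgar⟩
    · filter_upwards [hmean, hres (hR.pairing_error_eq hu), hclose] with τ h1 h2 h3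
      exact pairing_error_le_of_close hν h1 h2 (h3 _)
    · filter_upwards [hmean, hres (hR.pairing_error_eq hu), hgar] with τ h1 h2 h3
      exact pairing_error_le_of_garding hν (u := u τ) (w := w τ) (by abel) hβ hαβ h1 h2 h3
  have hsub' : Icc s t ⊆ Icc s r := Icc_subset_Icc_right ht.2
  have hi1 : IntegrableOn (fun τ => (u' τ - w' τ) (u τ - w τ)) (Icc s t) :=
    he.integrable_pairing.mono_set (hsub'.trans hsub)
  have hi2 : IntegrableOn (fun τ => ‖u τ - w τ‖ ^ 2) (Icc s t) :=
    he.integrable_norm_sq.mono_set (hsub'.trans hsub)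
  have hi3 : IntegrableOn (fun τ => ‖R τ‖ ^ 2) (Icc s t) := by
    have h : IntegrableOn (fun τ => ‖R τ‖ ^ 2) (Icc a b) :=
      MemLp.integrable_norm_pow (β := VDual) (p := 2) (hR.memLp hab hf hw) (by simp)
    exact h.mono_set (hsub'.trans hsub)
  have henergy := hen s (hsub (left_mem_Icc.2 hsr.le)) t (hsub ht)
  rw [intervalIntegral.integral_of_le ht.1, ← integral_Icc_eq_integral_Ioc] at henergy
  have hmono := integral_mono_ae ((hi1.const_mul 2).add (hi2.const_mul (ν / 4)))
    (hi3.const_mul (4 / ν)) (ae_restrict_of_ae_restrict_of_subset hsub' hpt)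
  simp only [Pi.add_apply] at hmono
  rw [integral_add (hi1.const_mul 2) (hi2.const_mul (ν / 4)), integral_const_mul,
    integral_const_mul, integral_const_mul] at hmono
  have h4 : ∫ τ in Icc s t, (u' - w') τ ((u - w) τ) =
      ∫ τ in Icc s t, (u' τ - w' τ) (u τ - w τ) := rfl
  rw [h4] at henergy
  linarith

end PeriodicNSE

theorem theorem2p1 (ν : ℝ) (hν : 0 < ν) :
    -- the residual is a well-defined element of `L²(a, b; 𝒱')`
    (∀ (a b : ℝ) (f : ℝ → PeriodicNSE.VDual) (w : ℝ → PeriodicNSE.V) (w' : ℝ → PeriodicNSE.VDual),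
      a < b → MemLp f 2 (volume.restrict (Icc a b)) → PeriodicNSE.IsTrajectory a b w w' →
      ∃ R : ℝ → PeriodicNSE.VDual, MemLp R 2 (volume.restrict (Icc a b)) ∧
        PeriodicNSE.IsResidual ν a b f w w' R) ∧
    -- efficiency
    (∀ a b M : ℝ, a < b → ∃ C : ℝ,
      ∀ (f : ℝ → PeriodicNSE.VDual) (u : ℝ → PeriodicNSE.V) (u' : ℝ → PeriodicNSE.VDual),
      MemLp f 2 (volume.restrict (Icc a b)) →
      PeriodicNSE.IsWeakSolution ν a b f u u' →
      (∀ᵐ t ∂volume.restrict (Icc a b), ‖PeriodicNSE.vel (u t)‖ ≤ M) →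
      ∫ t in Icc a b, ‖u t‖ ^ 2 ≤ M ^ 2 →
      ∀ (N : ℝ) (w : ℝ → PeriodicNSE.V) (w' R : ℝ → PeriodicNSE.VDual),
      PeriodicNSE.IsTrajectory a b w w' →
      (∀ᵐ t ∂volume.restrict (Icc a b), ‖PeriodicNSE.vel (w t)‖ ≤ N) →
      PeriodicNSE.IsResidual ν a b f w w' R →
      ∫ t in Icc a b, ‖R t‖ ^ 2 ≤
        C * (1 + N ^ 2) *
          ((∫ t in Icc a b, ‖u t - w t‖ ^ 2) + ∫ t in Icc a b, ‖u' t - w' t‖ ^ 2)) ∧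
    -- reliability
    (∃ κ C : ℝ, 0 < κ ∧
      ∀ (a b s r : ℝ) (f : ℝ → PeriodicNSE.VDual) (u w : ℝ → PeriodicNSE.V)
        (u' w' R : ℝ → PeriodicNSE.VDual),
      a ≤ s → s < r → r ≤ b →
      MemLp f 2 (volume.restrict (Icc a b)) →
      PeriodicNSE.IsWeakSolution ν a b f u u' →
      PeriodicNSE.IsTrajectory a b w w' →
      PeriodicNSE.IsResidual ν a b f w w' R →
      (∀ᵐ t ∂volume.restrict (Icc s r),
        ∫ x, PeriodicNSE.vel (u t - w t) x ∂PeriodicNSE.torusMeasure = 0) →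
      (PeriodicNSE.IsClose (ν / 2) s r u w ∨
        PeriodicNSE.SatisfiesGarding ν s r u (u - w) (u' - w')) →
      ∃ e : ℝ → PeriodicNSE.L2Vec, ContinuousOn e (Icc s r) ∧
        (∀ᵐ t ∂volume.restrict (Icc s r), e t = PeriodicNSE.vel (u t - w t)) ∧
        (∀ t ∈ Icc s r,
          ‖e t‖ ^ 2 + κ * ∫ τ in Icc s t, ‖u τ - w τ‖ ^ 2 ≤
            ‖e s‖ ^ 2 + C * ∫ τ in Icc s t, ‖R τ‖ ^ 2) ∧
        (∀ t ∈ Icc s r,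
          ‖e t‖ ^ 2 + ∫ τ in Icc s r, ‖u τ - w τ‖ ^ 2 ≤
            C * (‖e s‖ ^ 2 + ∫ τ in Icc s r, ‖R τ‖ ^ 2))) := by
  refine ⟨fun a b f w w' hab hf hw => PeriodicNSE.exists_memLp_residual ν hab hf hw,
    fun a b M hab => ⟨_, fun f u u' _ hu hM hM2 N w w' R hw hN hR =>
      PeriodicNSE.integral_residual_sq_le hab hu hM hM2 hw hN hR⟩,
    ν / 4, (1 + 4 / ν) ^ 2, by positivity, ?_⟩
  intro a b s r f u w u' w' R has hsr hrb hf hu hw hR hmean hstab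
  obtain ⟨e, hec, hae, hest⟩ :=
    PeriodicNSE.exists_error_bound hν has hsr hrb hf hu hw hR hmean hstab
  have hab : a < b := by linarith
  have hsub : Icc s r ⊆ Icc a b := Icc_subset_Icc has hrb
  set q := 4 / ν with hq
  have hq0 : 0 < q := by positivity
  have hqν : q * (ν / 4) = 1 := by rw [hq]; field_simp
  have hiR : IntegrableOn (fun τ => ‖R τ‖ ^ 2) (Icc a b) :=
    MemLp.integrable_norm_pow (β := PeriodicNSE.VDual) (p := 2) (hR.memLp hab hf hw) (by simp)
  refine ⟨e, hec, hae, fun t ht => ?_, fun t ht => ?_⟩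
  · refine (hest t ht).trans ?_
    have h0 : 0 ≤ ∫ τ in Icc s t, ‖R τ‖ ^ 2 := integral_nonneg fun τ => by positivity
    gcongr
    nlinarith
  · have hIe0 : ∀ t, 0 ≤ ∫ τ in Icc s t, ‖u τ - w τ‖ ^ 2 := fun t =>
      integral_nonneg fun τ => by positivity
    have hRt : ∫ τ in Icc s t, ‖R τ‖ ^ 2 ≤ ∫ τ in Icc s r, ‖R τ‖ ^ 2 :=
      setIntegral_mono_set (hiR.mono_set hsub) (.of_forall fun τ => by
        simp only [Pi.zero_apply]; positivity) (Icc_subset_Icc_right ht.2).eventuallyLE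
    have h1 := hest t ht
    have h2 := hest r (right_mem_Icc.2 hsr.le)
    have hR0 : 0 ≤ ∫ τ in Icc s r, ‖R τ‖ ^ 2 := integral_nonneg fun τ => by positivity
    set I := ∫ τ in Icc s r, ‖R τ‖ ^ 2 with hI
    set E := ∫ τ in Icc s r, ‖u τ - w τ‖ ^ 2 with hE
    have h3 : ‖e t‖ ^ 2 ≤ ‖e s‖ ^ 2 + q * I := by
      have := mul_le_mul_of_nonneg_left hRt hq0.le
      have := mul_nonneg (by positivity : 0 ≤ ν / 4) (hIe0 t)
      linarith
    have h4 : E ≤ q * (‖e s‖ ^ 2 + q * I) := by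
      have h5 : ν / 4 * E ≤ ‖e s‖ ^ 2 + q * I := by linarith [sq_nonneg ‖e r‖]
      calc E = q * (ν / 4 * E) := by rw [← mul_assoc, hqν, one_mul]
        _ ≤ _ := by gcongr
    calc ‖e t‖ ^ 2 + E ≤ (1 + q) * (‖e s‖ ^ 2 + q * I) := by linarith
      _ ≤ (1 + q) * ((1 + q) * (‖e s‖ ^ 2 + I)) := by
          gcongr
          nlinarith [sq_nonneg ‖e s‖, mul_nonneg hq0.le (sq_nonneg ‖e s‖)]
      _ = (1 + q) ^ 2 * (‖e s‖ ^ 2 + I) := by ring
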